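/- **Setting.** A behavior is a set of trajectories $(u,y):\mathbb N_0\to\mathbb R^{m}\times\mathbb R^{p}$; let $\mathcal B_{[0,N-1]}$ denote the set of restrictions of its trajectories to the times $0,\dots,N-1$. A behavior is a linear, time-invariant, complete system if it is a vector space, is invariant under the backward shift $(\sigma w)(t)=w(t+1)$, and is closed under pointwise convergence. A state space representation $(A,B,C,D)$ of $\mathcal B$ has $\mathcal B=\{(u,y):\exists x,\ x(t+1)=Ax(t)+Bu(t),\ y(t)=Cx(t)+Du(t)\text{ for all }t\}$; it is minimal if its state dimension is least possible, and this least dimension is the McMillan degree $n(\mathcal B)$. The lag $l(\mathcal B)$ is the least $k\ge 0$ such that the matrix with block rows $C,CA,\dots,CA^{k-1}$ of a minimal representation has rank $n(\mathcal B)$; equivalently, it is the least $k\ge0$ such that every sequence all of whose windows of length $k+1$ lie in $\mathcal B_{[0,k]}$ belongs to $\mathcal B$, and the latter is used for systems with no prescribed input/output partition. $\mathcal B$ is controllable if for every $T$, every $w_p\in\mathcal B_{[0,T]}$ and every $w_f\in\mathcal B$ there are $\tilde T\ge 1$ and $v\in\mathcal B$ with $v|_{[0,T]}=w_p$ and $v(t)=w_f(t-T-\tilde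 T)$ for $t\ge T+\tilde T$. It has vector relative degree $(r_1,\dots,r_p)\in\mathbb N_0^p$ if, for a state space representation, $C_jA^kB=0$ for $0\le k\le r_j-2$ and $D_j=0$ if $r_j>0$, for all $j$, and the matrix with rows $D_j$ (if $r_j=0$) and $C_jA^{r_j-1}B$ (if $r_j>0$) has rank $p$. The zero dynamics are $\mathcal B_{ZD}=\{u:(u,0)\in\mathcal B\}$; they are stable if for every $u\in\mathcal B_{ZD}$, every minimal representation and every state trajectory $x$ of it that belongs to $(u,0)$, one has $x(t)\to0$ and $u(t)\to 0$ as $t\to\infty$. A finite signal $u_d:[0,T]\to\mathbb R^m$ is persistently exciting of order $k$ if the block Hankel matrix $(u_d(i+j))_{0\le i\le k-1,\,0\le j\le T-k+1}$ has rank $km$. A square real matrix is (Schur) stable if all its complex eigenvalues have absolute value strictly less than $1$; the $0\times0$ matrix is stable. **Theorem.** Let $\mathcal B$ be a controllable linear, time-invariant, complete system with $m$ inputs $u$ and $m$ outputs $y$, with $n(\mathcal B)>0$ and vector relative degree $(r_1,\dots,r_m)\in\mathbb N_0^m$. Write $l=l(\mathcal B)$, let $L\ge l+\max_{1\le j\le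 m} r_j+1$, and let $(u_d,y_d)\in\mathcal B_{[0,T]}$ be data with $u_d$ persistently exciting of order $L+n(\mathcal B)$. Let $\mathcal B_{MPUM}$ be the intersection of all linear, time-invariant, complete systems $\mathcal B'$ of lag at most $l$ with $(u_d,y_d)\in\mathcal B'_{[0,T]}$, let $$M=\{u\in(\mathbb R^m)^L:(u,0)\in\mathcal B_{MPUM,[0,L-1]}\},$$ let $\pi_k$ be the projection onto the first $k$ entries $(\mathbb R^m)^L\to(\mathbb R^m)^k$, and let $v_1,\dots,v_d$ be any basis of $\pi_lM$. Then: 1. $d=n(\mathcal B)-\sum_{j=1}^m r_j$. 2. For each $k$ there is a unique $u_k\in\mathbb R^m$ with $(v_k,u_k)\in\pi_{l+1}M$. 3. There is a unique matrix $\tilde Q=(q_{k,i})\in\mathbb R^{d\times d}$ with $(v_{k,2},\dots,v_{k,l},u_k)=\sum_{i=1}^d q_{k,i}v_i$ for all $k$. 4. The zero dynamics of $\mathcal B$ are stable if and only if $\tilde Q$ is stable. -/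

import Mathlib

open Filter Topology

/-! Discrete-time linear systems in the behavioral approach, over the time axis `ℕ = {0, 1, …}`. -/

/-- Signal value at one time: an input value in `ℝᵐ` together with an output value in `ℝᵖ`. -/
abbrev Signal (m p : ℕ) : Type := (Fin m → ℝ) × (Fin p → ℝ)

/-- A linear behavior: a linear space of trajectories `ℕ → ℝᵐ × ℝᵖ`. -/
abbrev Behavior (m p : ℕ) : Type := Submodule ℝ (ℕ → Signal m p)

/-- Restriction of a trajectory to the times `0, …, N - 1`. -/
def initialSegment (m p N : ℕ) : (ℕ → Signal m p) →ₗ[ℝ] (Fin N → Signal m p) :=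
  LinearMap.funLeft ℝ (Signal m p) (fun i : Fin N => (i : ℕ))

/-- A discrete-time state space system `x(t+1) = A x(t) + B u(t)`, `y(t) = C x(t) + D u(t)`. -/
structure StateSpace (m p n : ℕ) where
  A : Matrix (Fin n) (Fin n) ℝ
  B : Matrix (Fin n) (Fin m) ℝ
  C : Matrix (Fin p) (Fin n) ℝ
  D : Matrix (Fin p) (Fin m) ℝ

namespace StateSpace

variable {m p n : ℕ}

/-- The trajectory `w = (u, y)` and the state trajectory `x` satisfy the system equations. -/
def IsTrajectory (S : StateSpace m p n) (w : ℕ → Signal m p) (x : ℕ → Fin n → ℝ) : Prop :=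
  ∀ t, x (t + 1) = S.A.mulVec (x t) + S.B.mulVec (w t).1 ∧
    (w t).2 = S.C.mulVec (x t) + S.D.mulVec (w t).1

/-- `S` is a state space representation of the behavior `𝓑`. -/
def Represents (S : StateSpace m p n) (𝓑 : Behavior m p) : Prop :=
  ∀ w : ℕ → Signal m p, w ∈ 𝓑 ↔ ∃ x : ℕ → Fin n → ℝ, S.IsTrajectory w x

/-- The truncated observability matrix with block rows `C, C A, …, C A^(L-1)`. -/
def observabilityMatrix (S : StateSpace m p n) (L : ℕ) : Matrix (Fin L × Fin p) (Fin n) ℝ :=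
  Matrix.of fun i k => (S.C * S.A ^ (i.1 : ℕ)) i.2 k

/-- The decoupling matrix belonging to `r`: its `j`-th row is the `j`-th row of `D` if `r j = 0`,
and the `j`-th row of `C A^(r j - 1) B` otherwise. -/
def decouplingMatrix (S : StateSpace m p n) (r : Fin p → ℕ) : Matrix (Fin p) (Fin m) ℝ :=
  Matrix.of fun j => if r j = 0 then S.D j else (S.C * S.A ^ (r j - 1) * S.B) j

/-- `r` satisfies the two defining conditions of the vector relative degree of `S`. -/
def HasVectorRelativeDegree (S : StateSpace m p n) (r : Fin p → ℕ) : Prop :=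
  (∀ j, (∀ k : ℕ, k + 2 ≤ r j → (S.C * S.A ^ k * S.B) j = 0) ∧ (0 < r j → S.D j = 0)) ∧
    (S.decouplingMatrix r).rank = p

end StateSpace

namespace Behavior

variable {m p : ℕ}

/-- Time invariance (closedness under the backward shift) and completeness (closedness under
pointwise convergence) of a linear behavior. -/
structure IsLTIComplete (𝓑 : Behavior m p) : Prop where
  shift_mem : ∀ w ∈ 𝓑, (fun t => w (t + 1)) ∈ 𝓑
  isClosed : IsClosed (𝓑 : Set (ℕ → Signal m p))

/-- The set `𝓑_[0, N-1]` of restrictions of trajectories to the times `0, …, N - 1`. -/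
def restrict (𝓑 : Behavior m p) (N : ℕ) : Submodule ℝ (Fin N → Signal m p) :=
  Submodule.map (initialSegment m p N) 𝓑

/-- Controllability: any past `w_p|[0,T]` can be steered to any future trajectory after some
positive time distance. -/
def IsControllable (𝓑 : Behavior m p) : Prop :=
  ∀ T : ℕ, ∀ wp ∈ 𝓑.restrict (T + 1), ∀ wf ∈ 𝓑, ∃ d : ℕ, 0 < d ∧ ∃ v ∈ 𝓑,
    initialSegment m p (T + 1) v = wp ∧ ∀ t, T + d ≤ t → v t = wf (t - T - d)

/-- The McMillan degree: the least state dimension of a state space representation. -/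
noncomputable def mcMillanDegree (𝓑 : Behavior m p) : ℕ :=
  sInf {n | ∃ S : StateSpace m p n, S.Represents 𝓑}

/-- `S` is a minimal state space representation of `𝓑`. Its state dimension is the McMillan
degree. -/
def IsMinimalRepresentation (𝓑 : Behavior m p) (S : StateSpace m p 𝓑.mcMillanDegree) : Prop :=
  S.Represents 𝓑

/-- The lag: the least `L` for which the truncated observability matrix with `L` block rows of a
minimal representation has full column rank. -/
noncomputable def lag (𝓑 : Behavior m p) : ℕ :=
  sInf {L | ∃ S : StateSpace m p 𝓑.mcMillanDegree, 𝓑.IsMinimalRepresentation S ∧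
    (S.observabilityMatrix L).rank = 𝓑.mcMillanDegree}

/-- `r` is a vector relative degree of `𝓑`, read off from a state space representation with
input `u` and output `y`. -/
def HasVectorRelativeDegree (𝓑 : Behavior m p) (r : Fin p → ℕ) : Prop :=
  ∃ n, ∃ S : StateSpace m p n, S.Represents 𝓑 ∧ S.HasVectorRelativeDegree r

/-- The zero dynamics: all inputs `u` for which `(u, 0)` is a trajectory. -/
def zeroDynamics (𝓑 : Behavior m p) : Set (ℕ → Fin m → ℝ) :=
  {u | (fun t => (u t, 0)) ∈ 𝓑}

/-- Stability of the zero dynamics: along every trajectory `(u, 0)` of `𝓑`, the input and every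
corresponding state trajectory of every minimal representation tend to zero. -/
def HasStableZeroDynamics (𝓑 : Behavior m p) : Prop :=
  ∀ u ∈ 𝓑.zeroDynamics, ∀ S : StateSpace m p 𝓑.mcMillanDegree, 𝓑.IsMinimalRepresentation S →
    ∀ x : ℕ → Fin 𝓑.mcMillanDegree → ℝ, S.IsTrajectory (fun t => (u t, 0)) x →
      Tendsto x atTop (𝓝 0) ∧ Tendsto u atTop (𝓝 0)

/-- The behavior has lag at most `ℓ`, for behaviors without a prescribed input/output
partition: every sequence all of whose windows of length `ℓ + 1` are windows of the behavior
belongs to the behavior. -/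
def HasLagAtMost (𝓑 : Behavior m p) (ℓ : ℕ) : Prop :=
  ∀ v : ℕ → Signal m p,
    (∀ t, initialSegment m p (ℓ + 1) (fun s => v (t + s)) ∈ 𝓑.restrict (ℓ + 1)) → v ∈ 𝓑

end Behavior

/-- The Hankel matrix with `L` block rows of the finite signal `u(0), …, u(N-1)`. The block in
block row `i` and column `j` is `u(i+j)`. -/
def hankelMatrix {m N : ℕ} (u : Fin N → Fin m → ℝ) (L : ℕ) :
    Matrix (Fin L × Fin m) (Fin (N + 1 - L)) ℝ :=
  Matrix.of fun i j => u ⟨(i.1 : ℕ) + (j : ℕ), by omega⟩ i.2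

/-- Persistent excitation of order `L`. -/
def IsPersistentlyExciting {m N : ℕ} (u : Fin N → Fin m → ℝ) (L : ℕ) : Prop :=
  (hankelMatrix u L).rank = L * m

/-- The most powerful unfalsified model of the data `(u_d, y_d)` among the linear,
time-invariant, complete systems of lag at most `ℓ`: the intersection of all such systems that
explain the data. -/
def mostPowerfulUnfalsifiedModel {m p N : ℕ} (ℓ : ℕ) (ud : Fin N → Fin m → ℝ)
    (yd : Fin N → Fin p → ℝ) : Behavior m p :=
  sInf {𝓑 : Behavior m p | 𝓑.IsLTIComplete ∧ 𝓑.HasLagAtMost ℓ ∧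
    (fun i => (ud i, yd i)) ∈ 𝓑.restrict N}

/-- The space `M` of input sequences `u` of length `L` for which `(u, 0)` is a restricted
trajectory of the behavior `𝓑`. -/
def zeroOutputInputs {m p : ℕ} (𝓑 : Behavior m p) (L : ℕ) : Submodule ℝ (Fin L → Fin m → ℝ) :=
  Submodule.comap
    ((LinearMap.inl ℝ (Fin m → ℝ) (Fin p → ℝ)).compLeft (Fin L)) (𝓑.restrict L)

/-- The image `π_k M` of a space of sequences of length `L` under the projection onto the first
`k` entries. -/
def firstEntries {m k L : ℕ} (h : k ≤ L) (M : Submodule ℝ (Fin L → Fin m → ℝ)) :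
    Submodule ℝ (Fin k → Fin m → ℝ) :=
  Submodule.map (LinearMap.funLeft ℝ (Fin m → ℝ) (Fin.castLE h)) M

/-- The sequence `(v, c)` of length `ℓ + 1`. -/
def extend {m ℓ : ℕ} (v : Fin ℓ → Fin m → ℝ) (c : Fin m → ℝ) : Fin (ℓ + 1) → Fin m → ℝ :=
  Fin.snoc (α := fun _ => Fin m → ℝ) v c

/-- For `V = π_ℓ M`, `V' = π_(ℓ+1) M` and a basis `v` of `V`, the matrix `Q` is the one
constructed from the basis: for suitable continuations `c k` with `(v k, c k) ∈ V'`, row `k` of `Q`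
holds the coefficients with respect to `v` of the shifted sequence
`(v k 1, …, v k (ℓ-1), c k)`, where the entries of `v k` are numbered from `0`. -/
def IsContinuationMatrix {m ℓ d : ℕ} {V : Submodule ℝ (Fin ℓ → Fin m → ℝ)}
    (V' : Submodule ℝ (Fin (ℓ + 1) → Fin m → ℝ)) (v : Module.Basis (Fin d) ℝ V)
    (Q : Matrix (Fin d) (Fin d) ℝ) : Prop :=
  ∃ c : Fin d → Fin m → ℝ, ∀ k,
    extend (v k : Fin ℓ → Fin m → ℝ) (c k) ∈ V' ∧
      Fin.tail (extend (v k : Fin ℓ → Fin m → ℝ) (c k)) =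
        ∑ i, Q k i • (v i : Fin ℓ → Fin m → ℝ)

/-- Schur stability: all complex eigenvalues have absolute value less than one. -/
def IsSchurStable {d : ℕ} (Q : Matrix (Fin d) (Fin d) ℝ) : Prop :=
  ∀ z ∈ spectrum ℂ (Q.map (algebraMap ℝ ℂ)), ‖z‖ < 1

/-! Take a minimal representation that is observable within the lag `l`. Since the decoupling matrix
is invertible, the output is identically zero exactly when the initial state lies in W = {x : C_j
A^i x = 0 for all i < r_j} (`zeroingSubspace`) and the input is a fixed linear feedback u = Kx. The
update Z = A + BK preserves W, so the zero dynamics are the orbits of Z on W. The rows C_j A^i with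
i < r_j are independent, hence dim W = n - ∑ r_j.

The data enter through the fundamental lemma. Controllability makes the representation reachable,
and persistent excitation then makes the windows (state, L inputs) of the data span everything
(`span_state_input_windows`). Any shift-invariant model of the data therefore contains all windows
of 𝓑 of length L, and if its lag is at most l < L it contains 𝓑 itself. So the most powerful
unfalsified model is 𝓑.

Because L exceeds l by more than every r_j, π_k M for k = l, l + 1 is the set of first k inputs of
zeroing trajectories from W. Observability makes W → π_l M bijective, and this map turns Z into
"shift and continue". Hence `Q` is the transpose of a matrix of Z on W, and it is Schur stable if
and only if all orbits of Z on W tend to zero. For an arbitrary minimal representation,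
observability recovers convergence of the state from that of (u, 0). -/

/-- A linear map on the endomorphisms that vanishes on the first `finrank` powers of `f`
vanishes on all powers. -/
theorem map_pow_eq_zero_of_lt_finrank {X Z : Type*} [AddCommGroup X] [Module ℝ X]
    [FiniteDimensional ℝ X] [AddCommGroup Z] [Module ℝ Z] (f : Module.End ℝ X)
    (g : Module.End ℝ X →ₗ[ℝ] Z) (h : ∀ i < Module.finrank ℝ X, g (f ^ i) = 0) (k : ℕ) :
    g (f ^ k) = 0 := by
  rcases subsingleton_or_nontrivial X with hX | hX
  · rw [Subsingleton.elim (f ^ k) 0, map_zero]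
  -- By Cayley–Hamilton, f ^ k is a combination of powers below the degree of the characteristic
  -- polynomial.
  have hdeg : ((Polynomial.X ^ k : Polynomial ℝ) %ₘ f.charpoly).natDegree < Module.finrank ℝ X := by
    rw [← f.charpoly_natDegree]
    refine Polynomial.natDegree_modByMonic_lt _ f.charpoly_monic ?_
    intro h1
    have := f.charpoly_natDegree
    rw [h1, Polynomial.natDegree_one] at this
    exact Module.finrank_pos.ne this
  rw [LinearMap.pow_eq_aeval_mod_charpoly, Polynomial.aeval_eq_sum_range, map_sum]
  refine Finset.sum_eq_zero fun i hi => ?_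
  rw [map_smul, h i (by simp at hi; omega), smul_zero]

theorem Matrix.mulVec_injective_of_rank_eq_card {ι κ : Type*} [Fintype ι] [Fintype κ]
    (H : Matrix ι κ ℝ) (h : H.rank = Fintype.card κ) : Function.Injective H.mulVec := by
  have h1 := H.mulVecLin.finrank_range_add_finrank_ker
  rw [Module.finrank_fintype_fun_eq_card] at h1
  have h2 : Module.finrank ℝ (LinearMap.range H.mulVecLin) = Fintype.card κ := h
  have h3 : LinearMap.ker H.mulVecLin = ⊥ := Submodule.finrank_eq_zero.1 (by omega)
  exact LinearMap.ker_eq_bot.1 h3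

theorem Matrix.rank_eq_card_of_mulVec_injective {ι κ : Type*} [Fintype ι] [Fintype κ]
    (H : Matrix ι κ ℝ) (h : Function.Injective H.mulVec) : H.rank = Fintype.card κ := by
  have h1 := LinearMap.finrank_range_of_inj (f := H.mulVecLin) h
  rw [Module.finrank_fintype_fun_eq_card] at h1
  exact h1

/-! ### Persistent excitation and spanning windows -/

section FundamentalLemma

variable {X U : Type*} [AddCommGroup X] [Module ℝ X] [AddCommGroup U] [Module ℝ U]

/-- The operator on functionals of a state and an input window that corresponds to
advancing time by one step. -/
def advance (a : X →ₗ[ℝ] X) (b : U →ₗ[ℝ] X) :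
    Module.End ℝ (Module.Dual ℝ X × (ℕ → Module.Dual ℝ U)) where
  toFun w := (w.1 ∘ₗ a, fun i => Nat.casesOn i (w.1 ∘ₗ b) w.2)
  map_add' w w' := by
    refine Prod.ext rfl (funext fun i => ?_)
    cases i <;> rfl
  map_smul' c w := by
    refine Prod.ext rfl (funext fun i => ?_)
    cases i <;> rfl

/-- The functionals of the state and of an input window of length `K` that vanish along the
data `x`, `u` at the times below `J`. -/
def dataAnnihilator (x : ℕ → X) (u : ℕ → U) (K J : ℕ) :
    Submodule ℝ (Module.Dual ℝ X × (ℕ → Module.Dual ℝ U)) where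
  carrier := {w | (∀ i, K ≤ i → w.2 i = 0) ∧
    ∀ s < J, w.1 (x s) + ∑ i ∈ Finset.range K, w.2 i (u (s + i)) = 0}
  zero_mem' := by simp
  add_mem' := by
    rintro v w ⟨hv, hv'⟩ ⟨hw, hw'⟩
    refine ⟨fun i hi => by simp [hv i hi, hw i hi], fun s hs => ?_⟩
    have := congrArg₂ (· + ·) (hv' s hs) (hw' s hs)
    simp only [Prod.fst_add, Prod.snd_add, Pi.add_apply, LinearMap.add_apply,
      Finset.sum_add_distrib] at this ⊢
    linarith
  smul_mem' := by
    rintro c w ⟨hw, hw'⟩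
    refine ⟨fun i hi => by simp [hw i hi], fun s hs => ?_⟩
    have := congrArg (c * ·) (hw' s hs)
    simpa [mul_add, Finset.mul_sum] using this

variable {a : X →ₗ[ℝ] X} {b : U →ₗ[ℝ] X} {x : ℕ → X} {u : ℕ → U}

theorem advance_mem_dataAnnihilator (hx : ∀ t, x (t + 1) = a (x t) + b (u t)) {K J : ℕ}
    {w : Module.Dual ℝ X × (ℕ → Module.Dual ℝ U)} (hw : w ∈ dataAnnihilator x u K (J + 1)) :
    advance a b w ∈ dataAnnihilator x u (K + 1) J := by
  obtain ⟨h1, h2⟩ := hw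
  refine ⟨fun i hi => ?_, fun s hs => ?_⟩
  · obtain ⟨i, rfl⟩ : ∃ k, i = k + 1 := ⟨i - 1, by omega⟩
    exact h1 i (by omega)
  · have := h2 (s + 1) (by omega)
    rw [hx, map_add] at this
    rw [Finset.sum_range_succ']
    simp only [advance, LinearMap.coe_mk, AddHom.coe_mk, LinearMap.comp_apply, add_zero]
    rw [← this]
    have h3 : ∀ i, s + 1 + i = s + (i + 1) := fun i => by omega
    simp only [h3]
    change _ + (_ + w.1 (b (u s))) = _
    ring

theorem dataAnnihilator_mono {K K' J J' : ℕ} (hK : K ≤ K') (hJ : J' ≤ J) :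
    dataAnnihilator x u K J ≤ dataAnnihilator x u K' J' := by
  rintro w ⟨h1, h2⟩
  refine ⟨fun i hi => h1 i (hK.trans hi), fun s hs => ?_⟩
  rw [← h2 s (hs.trans_le hJ)]
  congr 1
  symm
  refine Finset.sum_subset (Finset.range_mono hK) fun i _ hi => ?_
  rw [h1 i (by simpa using hi), LinearMap.zero_apply]

theorem advance_pow_mem_dataAnnihilator (hx : ∀ t, x (t + 1) = a (x t) + b (u t)) {K J : ℕ}
    {w : Module.Dual ℝ X × (ℕ → Module.Dual ℝ U)} (i : ℕ)
    (hw : w ∈ dataAnnihilator x u K (J + i)) :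
    (advance a b ^ i) w ∈ dataAnnihilator x u (K + i) J := by
  induction i generalizing J with
  | zero => exact hw
  | succ i ih =>
    rw [pow_succ', Module.End.mul_apply]
    refine advance_mem_dataAnnihilator hx (ih ?_)
    rwa [add_assoc, add_comm 1 i]

theorem advance_pow_fst (w : Module.Dual ℝ X × (ℕ → Module.Dual ℝ U)) (i : ℕ) :
    ((advance a b ^ i) w).1 = w.1 ∘ₗ (a ^ i) := by
  induction i with
  | zero => rfl
  | succ i ih =>
    rw [pow_succ', Module.End.mul_apply, pow_succ]
    change ((advance a b ^ i) w).1 ∘ₗ a = _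
    rw [ih]
    rfl

theorem advance_pow_snd (w : Module.Dual ℝ X × (ℕ → Module.Dual ℝ U)) (i j : ℕ) :
    ((advance a b ^ i) w).2 j =
      if i ≤ j then w.2 (j - i) else w.1 ∘ₗ (a ^ (i - 1 - j)) ∘ₗ b := by
  induction i generalizing j with
  | zero => rfl
  | succ i ih =>
    rw [pow_succ', Module.End.mul_apply]
    cases j with
    | zero =>
      change ((advance a b ^ i) w).1 ∘ₗ b = _
      rw [advance_pow_fst]
      rfl
    | succ j =>
      change ((advance a b ^ i) w).2 j = _
      rw [ih]
      simp only [add_le_add_iff_right, Nat.add_sub_add_right]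
      congr 4
      omega

/-- If the input is persistently exciting and the pair `(a, b)` is reachable, then no nonzero
functional of the state and an input window vanishes along the data. -/
theorem eq_zero_of_mem_dataAnnihilator [FiniteDimensional ℝ X]
    (hx : ∀ t, x (t + 1) = a (x t) + b (u t))
    (hreach : ∀ ξ : Module.Dual ℝ X, (∀ k, ξ ∘ₗ (a ^ k) ∘ₗ b = 0) → ξ = 0) (L J : ℕ)
    (hpe : ∀ η : ℕ → Module.Dual ℝ U, (∀ i, L + Module.finrank ℝ X ≤ i → η i = 0) →
      (∀ s < J, ∑ i ∈ Finset.range (L + Module.finrank ℝ X), η i (u (s + i)) = 0) → η = 0)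
    {w : Module.Dual ℝ X × (ℕ → Module.Dual ℝ U)}
    (hw : w ∈ dataAnnihilator x u L (J + Module.finrank ℝ X)) : w = 0 := by
  set N := Module.finrank ℝ X with hN
  set c := a.charpoly.coeff with hc
  have hcN : c N = 1 := by
    have := a.charpoly_monic.coeff_natDegree
    rwa [a.charpoly_natDegree] at this
  have hdeg : a.charpoly.natDegree = N := a.charpoly_natDegree
  -- Applying the characteristic polynomial of `a` to `advance a b` kills the state part by
  -- Cayley–Hamilton. What remains is an input functional of length L + N, which persistent
  -- excitation kills.
  set g := ∑ i ∈ Finset.range (N + 1), c i • (advance a b ^ i) w with hg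
  have hgmem : g ∈ dataAnnihilator x u (L + N) J := by
    refine Submodule.sum_mem _ fun i hi => Submodule.smul_mem _ _ ?_
    have hi' : i ≤ N := by simpa [Nat.lt_succ_iff] using hi
    refine dataAnnihilator_mono (K := L + i) (J := J + N - i) (by omega) (by omega) ?_
    refine advance_pow_mem_dataAnnihilator hx i ?_
    rwa [Nat.sub_add_cancel (by omega)]
  have hg1 : g.1 = 0 := by
    rw [hg, Prod.fst_sum]
    simp only [Prod.smul_fst, advance_pow_fst]
    have h := a.aeval_self_charpoly
    rw [Polynomial.aeval_eq_sum_range, hdeg] at h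
    ext y
    have h' := congrArg (fun f : Module.End ℝ X => w.1 (f y)) h
    simpa [LinearMap.sum_apply] using h'
  have hg2 : g.2 = 0 := by
    refine hpe g.2 hgmem.1 fun s hs => ?_
    simpa [hg1] using hgmem.2 s hs
  have hcoeff : ∀ j, ∑ i ∈ Finset.range (N + 1), c i •
      (if i ≤ j then w.2 (j - i) else w.1 ∘ₗ (a ^ (i - 1 - j)) ∘ₗ b) = 0 := by
    intro j
    have h := congrFun hg2 j
    rw [hg, Prod.snd_sum, Finset.sum_apply] at h
    simpa only [Prod.smul_snd, Pi.smul_apply, advance_pow_snd, Pi.zero_apply] using h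
  have h2 : w.2 = 0 := by
    -- Descending induction from L: at index N + k the leading term is `w.2 k`, and all others
    -- involve `w.2` at larger indices.
    have : ∀ q k, L ≤ k + q → w.2 k = 0 := by
      intro q
      induction q with
      | zero => exact fun k hk => hw.1 k hk
      | succ q ih =>
        intro k hk
        have h := hcoeff (N + k)
        rw [Finset.sum_range_succ, Finset.sum_eq_zero, zero_add, hcN, one_smul,
          if_pos (by omega), Nat.add_sub_cancel_left] at h
        · exact h
        · intro i hi
          have hi' : i < N := by simpa using hi
          rw [if_pos (by omega), ih _ (by omega), smul_zero]
    exact funext fun k => this L k (by omega)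
  -- At index N - 1 - k the leading term is `w.1 ∘ₗ a ^ k ∘ₗ b`; the others contain `w.2` or smaller
  -- powers of `a`.
  have h1 : ∀ k < N, w.1 ∘ₗ (a ^ k) ∘ₗ b = 0 := by
    intro k
    induction k using Nat.strong_induction_on with
    | _ k ih =>
      intro hk
      have h := hcoeff (N - 1 - k)
      rw [Finset.sum_range_succ, Finset.sum_eq_zero, zero_add, hcN, one_smul,
        if_neg (by omega), show N - 1 - (N - 1 - k) = k by omega] at h
      · exact h
      · intro i hi
        have hi' : i < N := by simpa using hi
        split_ifs with hij
        · simp [h2]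
        · rw [ih _ (by omega) (by omega), smul_zero]
  refine Prod.ext (hreach _ fun k => ?_) h2
  exact map_pow_eq_zero_of_lt_finrank a
    { toFun := fun f => w.1 ∘ₗ f ∘ₗ b
      map_add' := fun f f' => by ext; simp
      map_smul' := fun r f => by ext; simp } h1 k

/-- Under persistent excitation and reachability, the states and input windows of the data span
the space of all initial states and input windows. -/
theorem span_state_input_windows [FiniteDimensional ℝ X]
    (hx : ∀ t, x (t + 1) = a (x t) + b (u t))
    (hreach : ∀ ξ : Module.Dual ℝ X, (∀ k, ξ ∘ₗ (a ^ k) ∘ₗ b = 0) → ξ = 0) (L J : ℕ)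
    (hpe : ∀ η : ℕ → Module.Dual ℝ U, (∀ i, L + Module.finrank ℝ X ≤ i → η i = 0) →
      (∀ s < J, ∑ i ∈ Finset.range (L + Module.finrank ℝ X), η i (u (s + i)) = 0) → η = 0) :
    Submodule.span ℝ (Set.range fun s : Fin (J + Module.finrank ℝ X) =>
      ((x s, fun i => u (s + i)) : X × (Fin L → U))) = ⊤ := by
  by_contra hne
  -- A proper span lies in the kernel of a nonzero functional, whose components on the state and on
  -- each input annihilate the data.
  obtain ⟨f, hf, hle⟩ := Submodule.exists_le_ker_of_lt_top _ (lt_top_iff_ne_top.2 hne)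
  apply hf
  have key := eq_zero_of_mem_dataAnnihilator hx hreach L J hpe
    (w := (f ∘ₗ LinearMap.inl ℝ X (Fin L → U), fun i => if h : i < L then
      f ∘ₗ LinearMap.inr ℝ X (Fin L → U) ∘ₗ LinearMap.single ℝ (fun _ : Fin L => U) ⟨i, h⟩
      else 0)) ?_
  · obtain ⟨k1, k2⟩ := Prod.ext_iff.1 key
    refine LinearMap.prod_ext k1 (LinearMap.pi_ext' fun i => ?_)
    have := congrFun k2 i
    simp only [i.2, dif_pos] at this
    exact this
  · refine ⟨fun i hi => dif_neg (by omega), fun s hs => ?_⟩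
    have h0 := hle (Submodule.subset_span (Set.mem_range_self (⟨s, hs⟩ : Fin _)))
    rw [LinearMap.mem_ker] at h0
    dsimp only at h0 ⊢
    rw [← h0, Finset.sum_range]
    have : ((x s, fun i : Fin L => u (s + i)) : X × (Fin L → U)) =
        LinearMap.inl ℝ X (Fin L → U) (x s) + ∑ i : Fin L,
          LinearMap.inr ℝ X (Fin L → U) (LinearMap.single ℝ (fun _ : Fin L => U) i (u (s + i))) := by
      have h1 : (fun i : Fin L => u (s + i)) =
          ∑ i : Fin L, LinearMap.single ℝ (fun _ : Fin L => U) i (u (s + i)) := by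
        funext i
        simp [Finset.sum_apply, Pi.single_apply]
      rw [← map_sum, ← h1]
      simp
    rw [this, map_add, map_sum]
    simp

end FundamentalLemma

/-- The functional form of persistent excitation. -/
theorem IsPersistentlyExciting.eq_zero_of_dual {m N K : ℕ} {ud : Fin N → Fin m → ℝ}
    (h : IsPersistentlyExciting ud K) {u : ℕ → Fin m → ℝ} (hu : ∀ i : Fin N, u i = ud i)
    (η : ℕ → Module.Dual ℝ (Fin m → ℝ)) (hη : ∀ i, K ≤ i → η i = 0)
    (h0 : ∀ s < N + 1 - K, ∑ i ∈ Finset.range K, η i (u (s + i)) = 0) : η = 0 := by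
  have hinj : Function.Injective (hankelMatrix ud K).transpose.mulVec := by
    refine Matrix.mulVec_injective_of_rank_eq_card _ ?_
    rw [Matrix.rank_transpose, h]
    simp
  have hz : (fun ij : Fin K × Fin m => η ij.1 (Pi.single ij.2 1)) = 0 := by
    apply hinj
    rw [Matrix.mulVec_zero]
    funext s
    rw [Pi.zero_apply, ← h0 s s.2, Finset.sum_range]
    simp only [Matrix.mulVec, dotProduct, Matrix.transpose_apply, Fintype.sum_prod_type]
    refine Finset.sum_congr rfl fun i _ => ?_
    rw [LinearMap.pi_apply_eq_sum_univ (η i) (u (s + i))]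
    refine Finset.sum_congr rfl fun j _ => ?_
    have := hu ⟨(i : ℕ) + s, by omega⟩
    simp only [hankelMatrix, Matrix.of_apply, smul_eq_mul, ← this, add_comm (s : ℕ)]
    congr 2
    funext k
    simp [Pi.single_apply, eq_comm]
  funext i
  by_cases hi : i < K
  · refine LinearMap.pi_ext' fun j => LinearMap.ext_ring ?_
    simpa using congrFun hz (⟨i, hi⟩, j)
  · exact hη i (by omega)

/-! ### Schur stability and matrix powers -/

section SchurStability

attribute [local instance] Matrix.linftyOpNormedRing Matrix.linftyOpNormedAlgebra

/-- A real matrix is Schur stable if and only if its powers tend to zero. -/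
theorem isSchurStable_iff_tendsto_pow {d : ℕ} (Q : Matrix (Fin d) (Fin d) ℝ) :
    IsSchurStable Q ↔ ∀ i j, Tendsto (fun t : ℕ => (Q ^ t) i j) atTop (𝓝 0) := by
  rcases Nat.eq_zero_or_pos d with rfl | hd
  · refine ⟨fun _ i => i.elim0, fun _ z hz => ?_⟩
    rw [spectrum.of_subsingleton] at hz
    exact hz.elim
  have : Nonempty (Fin d) := ⟨⟨0, hd⟩⟩
  set P : Matrix (Fin d) (Fin d) ℂ := Q.map (algebraMap ℝ ℂ) with hP
  have hpow : ∀ t, P ^ t = (Q ^ t).map (algebraMap ℝ ℂ) := fun t =>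
    (map_pow (algebraMap ℝ ℂ).mapMatrix Q t).symm
  have hPQ : (∀ i j, Tendsto (fun t : ℕ => (Q ^ t) i j) atTop (𝓝 0)) ↔
      Tendsto (fun t : ℕ => P ^ t) atTop (𝓝 0) := by
    refine Iff.trans ?_ (tendsto_pi_nhds (f := fun t : ℕ => P ^ t)).symm
    refine forall_congr' fun i => Iff.trans ?_ tendsto_pi_nhds.symm
    refine forall_congr' fun j => ?_
    simp only [hpow, Matrix.map_apply, Matrix.zero_apply, Complex.coe_algebraMap]
    rw [← Complex.ofReal_zero]
    refine ⟨fun h => (Complex.continuous_ofReal.tendsto _).comp h, fun h => ?_⟩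
    simpa [Function.comp_def] using (Complex.continuous_re.tendsto _).comp h
  rw [hPQ]
  constructor
  · intro h
    have hr : spectralRadius ℂ P < 1 := by
      have := spectrum.spectralRadius_lt_of_forall_lt P (r := 1) fun z hz => by
        simpa [← NNReal.coe_lt_coe] using h z hz
      simpa using this
    obtain ⟨q, hq1, hq2⟩ := exists_between hr
    -- Gelfand's formula bounds the norm of P ^ t by q ^ t eventually, with q strictly between the
    -- spectral radius and 1.
    have hG := spectrum.pow_nnnorm_pow_one_div_tendsto_nhds_spectralRadius P
    have hev := hG.eventually_lt_const hq1
    lift q to NNReal using hq2.ne_top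
    have hq : q < 1 := by exact_mod_cast hq2
    refine squeeze_zero_norm' (a := fun t : ℕ => (q : ℝ) ^ t) ?_
      (tendsto_pow_atTop_nhds_zero_of_lt_one q.2 hq)
    filter_upwards [hev, eventually_gt_atTop 0] with t ht ht0
    have h2 := ENNReal.rpow_le_rpow ht.le (z := t) (by positivity)
    rw [← ENNReal.rpow_mul, one_div, inv_mul_cancel₀ (by positivity), ENNReal.rpow_one,
      ENNReal.rpow_natCast] at h2
    exact_mod_cast h2
  · intro h z hz
    by_contra! hz1
    -- z ^ t lies in the spectrum of P ^ t, so the powers cannot tend to zero when |z| ≥ 1.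
    have hle : ∀ t : ℕ, 1 ≤ ‖P ^ t‖ * ‖(1 : Matrix (Fin d) (Fin d) ℂ)‖ := fun t =>
      (one_le_pow₀ hz1).trans
        ((norm_pow z t).symm.le.trans
          (spectrum.norm_le_norm_mul_of_mem (spectrum.pow_mem_pow P t hz)))
    have h3 := h.norm.mul_const ‖(1 : Matrix (Fin d) (Fin d) ℂ)‖
    rw [norm_zero, zero_mul] at h3
    exact absurd (ge_of_tendsto' h3 hle) (by norm_num)

end SchurStability

/-! ### State trajectories, observability and minimality -/

namespace StateSpace

variable {m p n : ℕ}

/-- The state trajectory from the initial state `x₀` under the input `u`. -/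
def run (S : StateSpace m p n) (x₀ : Fin n → ℝ) (u : ℕ → Fin m → ℝ) : ℕ → Fin n → ℝ
  | 0 => x₀
  | t + 1 => S.A.mulVec (S.run x₀ u t) + S.B.mulVec (u t)

/-- The system trajectory from the initial state `x₀` under the input `u`. -/
def response (S : StateSpace m p n) (x₀ : Fin n → ℝ) (u : ℕ → Fin m → ℝ) : ℕ → Signal m p :=
  fun t => (u t, S.C.mulVec (S.run x₀ u t) + S.D.mulVec (u t))

theorem isTrajectory_response (S : StateSpace m p n) (x₀ : Fin n → ℝ) (u : ℕ → Fin m → ℝ) :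
    S.IsTrajectory (S.response x₀ u) (S.run x₀ u) :=
  fun _ => ⟨rfl, rfl⟩

/-- The joint system and state trajectories form a linear space. -/
def trajectories (S : StateSpace m p n) :
    Submodule ℝ ((ℕ → Signal m p) × (ℕ → Fin n → ℝ)) where
  carrier := {q | S.IsTrajectory q.1 q.2}
  zero_mem' := fun t => by simp
  add_mem' := by
    intro q q' h h' t
    simp only [Prod.fst_add, Prod.snd_add, Pi.add_apply, Matrix.mulVec_add, (h t).1, (h t).2,
      (h' t).1, (h' t).2]
    constructor <;> abel
  smul_mem' := by
    intro c q h t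
    simp only [Prod.smul_fst, Prod.smul_snd, Pi.smul_apply, Matrix.mulVec_smul, (h t).1, (h t).2,
      smul_add, true_and]

variable {S : StateSpace m p n} {w w' : ℕ → Signal m p} {x x' : ℕ → Fin n → ℝ}

theorem IsTrajectory.shift (h : S.IsTrajectory w x) (s : ℕ) :
    S.IsTrajectory (fun t => w (s + t)) (fun t => x (s + t)) :=
  fun t => h (s + t)

theorem IsTrajectory.state_eq (h : S.IsTrajectory w x) (h' : S.IsTrajectory w' x')
    (h0 : x 0 = x' 0) {t : ℕ} (hu : ∀ i < t, (w i).1 = (w' i).1) : x t = x' t := by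
  induction t with
  | zero => exact h0
  | succ t ih =>
    rw [(h t).1, (h' t).1, ih fun i hi => hu i (by omega), hu t (by omega)]

theorem IsTrajectory.eq_of_input_eq (h : S.IsTrajectory w x) (h' : S.IsTrajectory w' x')
    (h0 : x 0 = x' 0) {L : ℕ} (hu : ∀ i < L, (w i).1 = (w' i).1) {t : ℕ} (ht : t < L) :
    w t = w' t := by
  refine Prod.ext (hu t ht) ?_
  rw [(h t).2, (h' t).2, h.state_eq h' h0 fun i hi => hu i (by omega), hu t ht]

/-- Only the zero state is unobservable over `L` steps. -/
def IsObservableIn (S : StateSpace m p n) (L : ℕ) : Prop :=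
  ∀ x : Fin n → ℝ, (∀ i < L, S.C.mulVec ((S.A ^ i).mulVec x) = 0) → x = 0

theorem isObservableIn_iff_rank (S : StateSpace m p n) (L : ℕ) :
    S.IsObservableIn L ↔ (S.observabilityMatrix L).rank = n := by
  have key : ∀ x, (S.observabilityMatrix L).mulVec x = 0 ↔
      ∀ i < L, S.C.mulVec ((S.A ^ i).mulVec x) = 0 := by
    intro x
    have : ∀ i : Fin L, ∀ j, (S.observabilityMatrix L).mulVec x (i, j) =
        S.C.mulVec ((S.A ^ (i : ℕ)).mulVec x) j := by
      intro i j
      rw [Matrix.mulVec_mulVec]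
      rfl
    constructor
    · intro h i hi
      funext j
      rw [← this ⟨i, hi⟩ j, h]
      rfl
    · intro h
      funext ⟨i, j⟩
      rw [this, h i i.2]
      rfl
  constructor
  · intro h
    have := Matrix.rank_eq_card_of_mulVec_injective (S.observabilityMatrix L) (by
      intro y z hyz
      rw [← sub_eq_zero]
      refine h _ ((key _).1 ?_)
      rw [Matrix.mulVec_sub, hyz, sub_self])
    simpa using this
  · intro h y hy
    refine Matrix.mulVec_injective_of_rank_eq_card (S.observabilityMatrix L) (by simpa using h) ?_
    rw [(key y).2 hy, Matrix.mulVec_zero]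

/-- Equal inputs cancel in the difference of the states, which thus evolves freely under A with zero
output for L steps. The two starting times may differ, so shifted trajectories can be compared. -/
theorem IsObservableIn.state_eq {L : ℕ} (hS : S.IsObservableIn L) (h : S.IsTrajectory w x)
    (h' : S.IsTrajectory w' x') {t t' : ℕ} (hw : ∀ i < L, w (t + i) = w' (t' + i)) :
    x t = x' t' := by
  have hst : ∀ i ≤ L, x (t + i) - x' (t' + i) = (S.A ^ i).mulVec (x t - x' t') := by
    intro i
    induction i with
    | zero => simp
    | succ i ih =>
      intro hi
      rw [← add_assoc, ← add_assoc, (h _).1, (h' _).1, hw i (by omega), add_sub_add_right_eq_sub,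
        ← Matrix.mulVec_sub, ih (by omega), Matrix.mulVec_mulVec, pow_succ']
  rw [← sub_eq_zero]
  refine hS _ fun i hi => ?_
  rw [← hst i hi.le, Matrix.mulVec_sub, sub_eq_zero]
  have h1 := (h (t + i)).2
  rw [hw i hi, (h' (t' + i)).2] at h1
  exact (add_right_cancel h1).symm

theorem IsObservableIn.of_forall (h : ∀ x : Fin n → ℝ,
    (∀ i, S.C.mulVec ((S.A ^ i).mulVec x) = 0) → x = 0) : S.IsObservableIn n := by
  intro x hx
  have hpow : ∀ i, (S.A.mulVecLin ^ i) x = (S.A ^ i).mulVec x := fun i =>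
    (LinearMap.congr_fun (Matrix.toLin'_pow S.A i) x).symm
  refine h x fun i => ?_
  rw [← hpow]
  refine map_pow_eq_zero_of_lt_finrank S.A.mulVecLin
    (S.C.mulVecLin.comp (LinearMap.applyₗ x)) (fun k hk => ?_) i
  change S.C.mulVec ((S.A.mulVecLin ^ k) x) = 0
  rw [hpow]
  exact hx k (by simpa using hk)

/-- If a state space system has nonzero unobservable states, then its behavior has a
representation of smaller dimension. -/
theorem Represents.exists_lt {𝓑 : Behavior m p} (hS : S.Represents 𝓑) {x₀ : Fin n → ℝ}
    (hx₀ : x₀ ≠ 0) (hobs : ∀ i, S.C.mulVec ((S.A ^ i).mulVec x₀) = 0) :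
    ∃ k < n, ∃ S' : StateSpace m p k, S'.Represents 𝓑 := by
  let O : Submodule ℝ (Fin n → ℝ) :=
    { carrier := {x | ∀ i, S.C.mulVec ((S.A ^ i).mulVec x) = 0}
      zero_mem' := fun i => by simp
      add_mem' := fun {y z} hy hz i => by simp [Matrix.mulVec_add, hy i, hz i]
      smul_mem' := fun c y hy i => by simp [Matrix.mulVec_smul, hy i] }
  have hOA : ∀ y ∈ O, S.A.mulVec y ∈ O := fun y hy i => by
    have := hy (i + 1)
    rwa [pow_succ, ← Matrix.mulVec_mulVec] at this
  have hOC : ∀ y ∈ O, S.C.mulVec y = 0 := fun y hy => by simpa using hy 0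
  have hpos : 0 < Module.finrank ℝ O := by
    have : Nontrivial O := ⟨⟨x₀, hobs⟩, 0, fun h => hx₀ (congrArg Subtype.val h)⟩
    exact Module.finrank_pos
  have hsum := O.finrank_quotient_add_finrank
  rw [Module.finrank_fin_fun] at hsum
  set k := Module.finrank ℝ ((Fin n → ℝ) ⧸ O) with hk
  let e : ((Fin n → ℝ) ⧸ O) ≃ₗ[ℝ] (Fin k → ℝ) :=
    LinearEquiv.ofFinrankEq _ _ (by rw [Module.finrank_fin_fun])
  let π : (Fin n → ℝ) →ₗ[ℝ] (Fin k → ℝ) := e.toLinearMap ∘ₗ O.mkQ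
  have hπs : Function.Surjective π := e.surjective.comp O.mkQ_surjective
  have hπ : ∀ y, π y = 0 → y ∈ O := fun y hy => by
    have h1 : e (O.mkQ y) = 0 := hy
    rw [e.map_eq_zero_iff] at h1
    simpa using h1
  have hπO : ∀ y ∈ O, π y = 0 := fun y hy => by
    have h1 : O.mkQ y = 0 := by simpa using hy
    change e (O.mkQ y) = 0
    rw [h1, map_zero]
  obtain ⟨s, hs⟩ := π.exists_rightInverse_of_surjective (LinearMap.range_eq_top.2 hπs)
  have hs' : ∀ z, π (s z) = z := fun z => LinearMap.congr_fun hs z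
  have hdiff : ∀ y, y - s (π y) ∈ O := fun y => hπ _ (by rw [map_sub, hs', sub_self])
  -- The system induced on the quotient by the unobservable subspace O. The section `s` does no
  -- harm, as O is A-invariant and contained in ker C.
  let S' : StateSpace m p k :=
    { A := LinearMap.toMatrix' (π ∘ₗ S.A.mulVecLin ∘ₗ s)
      B := LinearMap.toMatrix' (π ∘ₗ S.B.mulVecLin)
      C := LinearMap.toMatrix' (S.C.mulVecLin ∘ₗ s)
      D := S.D }
  have hA : ∀ y, S'.A.mulVec (π y) = π (S.A.mulVec y) := fun y => by
    have h1 := hπO _ (hOA _ (hdiff y))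
    rw [Matrix.mulVec_sub, map_sub, sub_eq_zero] at h1
    rw [h1]
    exact LinearMap.toMatrix'_mulVec _ _
  have hB : ∀ c, S'.B.mulVec c = π (S.B.mulVec c) := fun c => LinearMap.toMatrix'_mulVec _ _
  have hC : ∀ y, S'.C.mulVec (π y) = S.C.mulVec y := fun y => by
    have h1 := hOC _ (hdiff y)
    rw [Matrix.mulVec_sub, sub_eq_zero] at h1
    rw [h1]
    exact LinearMap.toMatrix'_mulVec _ _
  have hproj : ∀ w x, S.IsTrajectory w x → S'.IsTrajectory w (fun t => π (x t)) := by
    intro w x h t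
    refine ⟨?_, ?_⟩
    · change π (x (t + 1)) = _
      rw [(h t).1, map_add, hA, hB]
    · rw [hC]
      exact (h t).2
  refine ⟨k, by omega, S', fun w => ?_⟩
  rw [hS w]
  constructor
  · rintro ⟨x, hx⟩
    exact ⟨_, hproj w x hx⟩
  · rintro ⟨z, hz⟩
    -- Lift the initial state and run `S` with the same input; the projected run starts at `z 0`, so
    -- the outputs agree.
    have h1 := S.isTrajectory_response (s (z 0)) (fun t => (w t).1)
    have h2 := hproj _ _ h1
    have h3 : w = S.response (s (z 0)) (fun t => (w t).1) := by
      funext t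
      exact hz.eq_of_input_eq h2 (hs' (z 0)).symm (L := t + 1) (fun i _ => rfl) (Nat.lt_succ_self t)
    rw [h3]
    exact ⟨_, h1⟩

theorem Represents.mem_of_isTrajectory {𝓑 : Behavior m p} (hS : S.Represents 𝓑)
    (h : S.IsTrajectory w x) : w ∈ 𝓑 :=
  (hS w).2 ⟨x, h⟩

/-- The response to an impulse at time `L` shows the Markov parameters. -/
theorem IsTrajectory.impulse {L : ℕ} (h : S.IsTrajectory w x) (h0 : x 0 = 0) {c : Fin m → ℝ}
    (hu : ∀ t, (w t).1 = if t = L then c else 0) :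
    (∀ t < L, w t = 0) ∧ (w L).2 = S.D.mulVec c ∧
      ∀ k, (w (L + 1 + k)).2 = (S.C * S.A ^ k * S.B).mulVec c := by
  have h1 : ∀ t ≤ L, x t = 0 := by
    intro t
    induction t with
    | zero => exact fun _ => h0
    | succ t ih =>
      intro ht
      rw [(h t).1, ih (by omega), hu, if_neg (by omega)]
      simp
  have h2 : ∀ k, x (L + 1 + k) = (S.A ^ k * S.B).mulVec c := by
    intro k
    induction k with
    | zero => simp [(h L).1, h1 L le_rfl, hu]
    | succ k ih =>
      rw [← add_assoc, (h _).1, ih, hu, if_neg (by omega), Matrix.mulVec_zero, add_zero,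
        Matrix.mulVec_mulVec, pow_succ', Matrix.mul_assoc]
  refine ⟨fun t ht => Prod.ext ?_ ?_, ?_, fun k => ?_⟩
  · rw [hu, if_neg ht.ne]
    rfl
  · rw [(h t).2, h1 t ht.le, hu, if_neg ht.ne]
    simp
  · rw [(h L).2, h1 L le_rfl, hu, if_pos rfl]
    simp
  · rw [(h _).2, h2, hu, if_neg (by omega), Matrix.mulVec_zero, add_zero, Matrix.mulVec_mulVec,
      Matrix.mul_assoc]

/-- Representations of the same behavior have the same Markov parameters. -/
theorem Represents.markov_eq {𝓑 : Behavior m p} (hS : S.Represents 𝓑) {L : ℕ}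
    (hobs : S.IsObservableIn L) {k : ℕ} {S' : StateSpace m p k} (hS' : S'.Represents 𝓑) :
    S'.D = S.D ∧ ∀ i, S'.C * S'.A ^ i * S'.B = S.C * S.A ^ i * S.B := by
  have key : ∀ c : Fin m → ℝ, S'.D.mulVec c = S.D.mulVec c ∧
      ∀ i, (S'.C * S'.A ^ i * S'.B).mulVec c = (S.C * S.A ^ i * S.B).mulVec c := by
    intro c
    -- The impulse is delayed to time L so that the L preceding zero samples force the initial state
    -- in `S` to vanish too.
    have h' := S'.isTrajectory_response 0 (fun t => if t = L then c else 0)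
    obtain ⟨a1, a2, a3⟩ := h'.impulse rfl (fun t => rfl)
    obtain ⟨x, hx⟩ := (hS _).1 (hS'.mem_of_isTrajectory h')
    have hx0 : x 0 = 0 := by
      refine hobs.state_eq hx (S.trajectories.zero_mem) (t' := 0) fun i hi => ?_
      rw [zero_add, a1 i hi]
      rfl
    obtain ⟨-, b2, b3⟩ := hx.impulse hx0 (fun t => rfl)
    exact ⟨a2.symm.trans b2, fun i => (a3 i).symm.trans (b3 i)⟩
  exact ⟨Matrix.ext_of_mulVec_single fun j => (key _).1,
    fun i => Matrix.ext_of_mulVec_single fun j => (key _).2 i⟩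

/-- The conditions involve only Markov parameters, so they pass from the witnessing representation
to any observable one. -/
theorem Represents.hasVectorRelativeDegree {𝓑 : Behavior m p} (hS : S.Represents 𝓑) {L : ℕ}
    (hobs : S.IsObservableIn L) {r : Fin p → ℕ} (hr : 𝓑.HasVectorRelativeDegree r) :
    S.HasVectorRelativeDegree r := by
  obtain ⟨k, S', hS', h1, h2⟩ := hr
  obtain ⟨hD, hM⟩ := hS.markov_eq hobs hS'
  simp only [decouplingMatrix, hD, hM] at h1 h2
  exact ⟨h1, h2⟩

/-- If inputs and outputs of an observable system tend to zero, then so does the state. -/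
theorem IsObservableIn.tendsto_state {L : ℕ} (hS : S.IsObservableIn L) (h : S.IsTrajectory w x)
    (hw : Tendsto w atTop (𝓝 0)) : Tendsto x atTop (𝓝 0) := by
  have hu : Tendsto (fun t => (w t).1) atTop (𝓝 0) := (continuous_fst.tendsto _).comp hw
  have hy : Tendsto (fun t => (w t).2) atTop (𝓝 0) := (continuous_snd.tendsto _).comp hw
  have hmul : ∀ {a : ℕ} (P : Matrix (Fin a) (Fin m) ℝ),
      Tendsto (fun t => P.mulVec (w t).1) atTop (𝓝 0) := fun P => by
    have := ((LinearMap.continuous_of_finiteDimensional P.mulVecLin).tendsto 0).comp hu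
    rw [map_zero] at this
    exact this
  -- Induction on i through C A^(i+1) x(t) = C A^i x(t+1) - C A^i B u(t).
  have key : ∀ i, Tendsto (fun t => S.C.mulVec ((S.A ^ i).mulVec (x t))) atTop (𝓝 0) := by
    intro i
    induction i with
    | zero =>
      have := hy.sub (hmul S.D)
      rw [sub_zero] at this
      refine this.congr fun t => ?_
      rw [(h t).2, add_sub_cancel_right, pow_zero, Matrix.one_mulVec]
    | succ i ih =>
      have := (ih.comp (tendsto_add_atTop_nat 1)).sub (hmul (S.C * S.A ^ i * S.B))
      rw [sub_zero] at this
      refine this.congr fun t => ?_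
      simp only [Function.comp_apply, (h t).1, Matrix.mulVec_add, Matrix.mulVec_mulVec, pow_succ,
        Matrix.mul_assoc, add_sub_cancel_right]
  let J : (Fin n → ℝ) →ₗ[ℝ] (Fin L → Fin p → ℝ) :=
    LinearMap.pi fun i => S.C.mulVecLin ∘ₗ (S.A ^ (i : ℕ)).mulVecLin
  have hJ : LinearMap.ker J = ⊥ := by
    refine LinearMap.ker_eq_bot'.2 fun y hy => hS y fun i hi => ?_
    exact congrFun hy ⟨i, hi⟩
  obtain ⟨g, hg⟩ := J.exists_leftInverse_of_injective hJ
  have hJx : Tendsto (fun t => J (x t)) atTop (𝓝 0) := tendsto_pi_nhds.2 fun i => key i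
  have := ((LinearMap.continuous_of_finiteDimensional g).tendsto 0).comp hJx
  rw [map_zero] at this
  exact this.congr fun t => LinearMap.congr_fun hg (x t)

end StateSpace

/-! ### The fundamental lemma and identification of the behavior -/

namespace Behavior

variable {m p : ℕ} {𝓑 : Behavior m p}

theorem initialSegment_eq_iff {N : ℕ} {w w' : ℕ → Signal m p} :
    initialSegment m p N w = initialSegment m p N w' ↔ ∀ i < N, w i = w' i :=
  ⟨fun h i hi => congrFun h ⟨i, hi⟩, fun h => funext fun i => h i i.2⟩

theorem IsLTIComplete.shift_mem' (h : 𝓑.IsLTIComplete) {w : ℕ → Signal m p} (hw : w ∈ 𝓑) (s : ℕ) :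
    (fun t => w (s + t)) ∈ 𝓑 := by
  induction s with
  | zero => simpa using hw
  | succ s ih => simpa [add_assoc, add_comm 1] using h.shift_mem _ ih

/-- Otherwise the unobservable states could be factored out. This covers every minimal
representation, whereas the definition of `lag` only supplies one that is observable within the lag.
-/
theorem IsMinimalRepresentation.isObservableIn {S : StateSpace m p 𝓑.mcMillanDegree}
    (hS : 𝓑.IsMinimalRepresentation S) : S.IsObservableIn 𝓑.mcMillanDegree := by
  refine StateSpace.IsObservableIn.of_forall fun x hx => ?_
  by_contra hne
  obtain ⟨k, hk, hS'⟩ := StateSpace.Represents.exists_lt hS hne hx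
  exact absurd (Nat.sInf_le (s := {n | ∃ S : StateSpace m p n, S.Represents 𝓑}) hS')
    (not_le.2 hk)

/-- A behavior with a state space representation has a minimal one that is observable within
the lag. -/
theorem exists_isMinimalRepresentation {n : ℕ} {S : StateSpace m p n} (hS : S.Represents 𝓑) :
    ∃ S' : StateSpace m p 𝓑.mcMillanDegree, 𝓑.IsMinimalRepresentation S' ∧
      S'.IsObservableIn 𝓑.lag := by
  obtain ⟨S₁, hS₁⟩ : ∃ S' : StateSpace m p 𝓑.mcMillanDegree, S'.Represents 𝓑 :=
    Nat.sInf_mem (s := {n | ∃ S : StateSpace m p n, S.Represents 𝓑}) ⟨n, S, hS⟩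
  have hmin : 𝓑.IsMinimalRepresentation S₁ := hS₁
  obtain ⟨S₂, h1, h2⟩ := Nat.sInf_mem (s := {L | ∃ S : StateSpace m p 𝓑.mcMillanDegree,
    𝓑.IsMinimalRepresentation S ∧ (S.observabilityMatrix L).rank = 𝓑.mcMillanDegree})
    ⟨_, S₁, hmin, (S₁.isObservableIn_iff_rank _).1 hmin.isObservableIn⟩
  exact ⟨S₂, h1, (S₂.isObservableIn_iff_rank _).2 h2⟩

/-- Every window of `ℓ + 1` steps determines a unique state if the representation is observable
in `ℓ` steps; hence the behavior has lag at most `ℓ`. -/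
theorem hasLagAtMost_of_isObservableIn {n ℓ : ℕ} {S : StateSpace m p n} (hS : S.Represents 𝓑)
    (hobs : S.IsObservableIn ℓ) : 𝓑.HasLagAtMost ℓ := by
  intro v hv
  have h1 : ∀ t, ∃ w x, S.IsTrajectory w x ∧ ∀ i < ℓ + 1, w i = v (t + i) := by
    intro t
    obtain ⟨w, hw, hwv⟩ := hv t
    obtain ⟨x, hx⟩ := (hS w).1 hw
    exact ⟨w, x, hx, initialSegment_eq_iff.1 hwv⟩
  choose w x hx hwv using h1
  refine hS.mem_of_isTrajectory (x := fun t => x t 0) fun t => ?_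
  -- Consecutive windows overlap in ℓ samples, which determine the state, so the local state
  -- trajectories glue.
  have h2 : x (t + 1) 0 = x t 1 := by
    refine hobs.state_eq (hx (t + 1)) (hx t) fun i hi => ?_
    rw [hwv (t + 1) (0 + i) (by omega), hwv t (1 + i) (by omega)]
    congr 1
    omega
  have h3 := hx t 0
  rw [hwv t 0 (by omega)] at h3
  exact ⟨h2.trans h3.1, h3.2⟩

/-- The observable representations of a controllable behavior are reachable. -/
theorem IsControllable.dual_eq_zero (hc : 𝓑.IsControllable) {n L : ℕ} {S : StateSpace m p n}
    (hS : S.Represents 𝓑) (hobs : S.IsObservableIn L) (ξ : Module.Dual ℝ (Fin n → ℝ))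
    (hξ : ∀ k, ξ ∘ₗ (S.A.mulVecLin ^ k) ∘ₗ S.B.mulVecLin = 0) : ξ = 0 := by
  refine LinearMap.ext fun x₁ => ?_
  have hf := S.isTrajectory_response x₁ 0
  -- Steer the zero window to the free response from `x₁`: observability gives state 0 at time 0 and
  -- `x₁` at time L + d. Since ξ kills every reachable state, ξ x₁ = 0.
  obtain ⟨d, -, v, hv, hv0, hvf⟩ := hc L 0 (Submodule.zero_mem _) _ (hS.mem_of_isTrajectory hf)
  obtain ⟨z, hz⟩ := (hS v).1 hv
  have hz0 : z 0 = 0 := by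
    refine hobs.state_eq hz (S.trajectories.zero_mem) (t' := 0) fun i hi => ?_
    rw [zero_add]
    exact congrFun hv0 ⟨i, by omega⟩
  have hz1 : z (L + d) = x₁ := by
    refine hobs.state_eq hz hf (t' := 0) fun i hi => ?_
    rw [hvf _ (by omega)]
    congr 1
    omega
  have key : ∀ t k, ξ ((S.A.mulVecLin ^ k) (z t)) = 0 := by
    intro t
    induction t with
    | zero => simp [hz0]
    | succ t ih =>
      intro k
      have h1 := LinearMap.congr_fun (hξ k) (v t).1
      have h2 := ih (k + 1)
      rw [pow_succ, Module.End.mul_apply] at h2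
      simp only [LinearMap.comp_apply, Matrix.mulVecLin_apply] at h1 h2
      rw [(hz t).1, map_add, map_add, h2, h1]
      simp
  have := key (L + d) 0
  rwa [hz1] at this

/-- The fundamental lemma: every linear time-invariant behavior that explains persistently
exciting data of a controllable system contains the restricted trajectories of that system. -/
theorem restrict_le_of_isPersistentlyExciting (hc : 𝓑.IsControllable) {n ℓ L N : ℕ}
    {S : StateSpace m p n} (hS : S.Represents 𝓑) (hobs : S.IsObservableIn ℓ) (hn : 0 < n)
    {ud : Fin N → Fin m → ℝ} {yd : Fin N → Fin p → ℝ}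
    (hdata : (fun i => (ud i, yd i)) ∈ 𝓑.restrict N)
    (hpe : IsPersistentlyExciting ud (L + n)) {𝓑' : Behavior m p} (h' : 𝓑'.IsLTIComplete)
    (hdata' : (fun i => (ud i, yd i)) ∈ 𝓑'.restrict N) : 𝓑.restrict L ≤ 𝓑'.restrict L := by
  have hreach := hc.dual_eq_zero hS hobs
  obtain ⟨wd, hwd, hwd1⟩ := hdata
  obtain ⟨wd', hwd', hwd1'⟩ := hdata'
  obtain ⟨xd, hxd⟩ := (hS wd).1 hwd
  -- Otherwise the Hankel matrix has no columns, which forces m = 0; reachability then contradicts n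
  -- > 0.
  have hN : L + n ≤ N := by
    by_contra hlt
    have hz : (hankelMatrix ud (L + n)).rank = 0 := by
      have := (hankelMatrix ud (L + n)).rank_le_card_width
      rw [Fintype.card_fin] at this
      omega
    have hm : m = 0 := by
      rw [hpe] at hz
      rcases Nat.mul_eq_zero.1 hz with h | h <;> omega
    subst hm
    have hsub : ∀ ξ : Module.Dual ℝ (Fin n → ℝ), ξ = 0 := fun ξ => hreach ξ fun k =>
      LinearMap.ext fun c => by rw [Subsingleton.elim c 0, map_zero, map_zero]
    have := congrArg (fun f => f (Pi.single (⟨0, hn⟩ : Fin n) (1 : ℝ)))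
      (hsub (LinearMap.proj (⟨0, hn⟩ : Fin n)))
    simp at this
  have hspan := span_state_input_windows (a := S.A.mulVecLin) (b := S.B.mulVecLin) (x := xd)
    (u := fun t => (wd t).1) (fun t => (hxd t).1) hreach L (N + 1 - (L + n)) (by
      rw [Module.finrank_fin_fun]
      intro η h1 h2
      exact hpe.eq_zero_of_dual (u := fun t => (wd t).1)
        (fun i => congrArg Prod.fst (congrFun hwd1 i)) η h1 h2)
  rw [Module.finrank_fin_fun] at hspan
  rintro _ ⟨w, hw, rfl⟩
  obtain ⟨x, hx⟩ := (hS w).1 hw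
  obtain ⟨g, hg⟩ := (Submodule.mem_span_range_iff_exists_fun ℝ).1
    (hspan.ge (Submodule.mem_top (x := (x 0, fun i : Fin L => (w i).1))))
  obtain ⟨hg1, hg2⟩ := Prod.ext_iff.1 hg
  rw [Prod.fst_sum] at hg1
  rw [Prod.snd_sum] at hg2
  have hcomb := Submodule.sum_mem S.trajectories (t := Finset.univ)
    fun (s : Fin (N + 1 - (L + n) + n)) _ =>
    Submodule.smul_mem S.trajectories (g s) 
      (show ((fun t => wd (s + t), fun t => xd (s + t)) : _ × _) ∈ S.trajectories from hxd.shift s)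
  have hcomb' : S.IsTrajectory (∑ s, g s • fun t => wd (s + t))
      (∑ s, g s • fun t => xd (s + t)) := by
    have : S.IsTrajectory _ _ := hcomb
    simpa only [Prod.fst_sum, Prod.snd_sum, Prod.smul_fst, Prod.smul_snd] using this
  -- Initial state and inputs determine a window, so `w` agrees on it with a combination of shifted
  -- data.
  have heq : initialSegment m p L w = initialSegment m p L (∑ s, g s • fun t => wd (s + t)) := by
    refine initialSegment_eq_iff.2 fun i hi => hx.eq_of_input_eq hcomb' ?_ ?_ hi
    · refine hg1.symm.trans ?_
      simp [Finset.sum_apply]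
    · intro j hj
      refine (congrFun hg2 ⟨j, hj⟩).symm.trans ?_
      simp [Finset.sum_apply, Prod.fst_sum]
  rw [heq, map_sum]
  refine Submodule.sum_mem _ fun s _ => ?_
  rw [map_smul]
  refine Submodule.smul_mem _ _ ⟨_, h'.shift_mem' hwd' s, ?_⟩
  refine initialSegment_eq_iff.2 fun i hi => ?_
  have hlt : (s : ℕ) + i < N := by omega
  exact (congrFun hwd1' ⟨s + i, hlt⟩).trans (congrFun hwd1 ⟨s + i, hlt⟩).symm

/-- For persistently exciting data, the most powerful unfalsified model is the system itself. -/
theorem mostPowerfulUnfalsifiedModel_eq (h𝓑 : 𝓑.IsLTIComplete) (hc : 𝓑.IsControllable)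
    {n ℓ L N : ℕ} {S : StateSpace m p n} (hS : S.Represents 𝓑) (hobs : S.IsObservableIn ℓ)
    (hn : 0 < n) (hL : ℓ + 1 ≤ L) {ud : Fin N → Fin m → ℝ} {yd : Fin N → Fin p → ℝ}
    (hdata : (fun i => (ud i, yd i)) ∈ 𝓑.restrict N)
    (hpe : IsPersistentlyExciting ud (L + n)) :
    mostPowerfulUnfalsifiedModel ℓ ud yd = 𝓑 := by
  refine le_antisymm (sInf_le ⟨h𝓑, hasLagAtMost_of_isObservableIn hS hobs, hdata⟩) ?_
  refine le_sInf fun 𝓑' h => ?_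
  obtain ⟨h1, h2, h3⟩ := h
  intro w hw
  -- The lag bound on `𝓑'` reduces membership to windows of length ℓ + 1 ≤ L.
  refine h2 w fun t => ?_
  have hle := restrict_le_of_isPersistentlyExciting hc hS hobs hn hdata hpe h1 h3
  obtain ⟨v, hv, hvw⟩ := hle ⟨_, h𝓑.shift_mem' hw t, rfl⟩
  refine ⟨v, hv, initialSegment_eq_iff.2 fun i hi => ?_⟩
  exact initialSegment_eq_iff.1 hvw i (by omega)

end Behavior

/-! ### Relative degree and output zeroing -/

namespace StateSpace

variable {m p n : ℕ}

/-- The rows `C_j A^(r j)` that describe the effect of the state on the outputs after the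
relative degree. -/
def delayedOutputMatrix (S : StateSpace m p n) (r : Fin p → ℕ) : Matrix (Fin p) (Fin n) ℝ :=
  Matrix.of fun j => (S.C * S.A ^ r j) j

/-- The states from which the outputs can be kept at zero: those in the kernel of all
`C_j A^i` with `i < r j`. -/
def zeroingSubspace (S : StateSpace m p n) (r : Fin p → ℕ) : Submodule ℝ (Fin n → ℝ) where
  carrier := {x | ∀ j, ∀ i < r j, (S.C * S.A ^ i).mulVec x j = 0}
  zero_mem' := fun j i _ => by simp
  add_mem' := fun {y z} hy hz j i hi => by simp [Matrix.mulVec_add, hy j i hi, hz j i hi]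
  smul_mem' := fun c y hy j i hi => by simp [Matrix.mulVec_smul, hy j i hi]

/-- The feedback that keeps the outputs at zero. -/
noncomputable def zeroingFeedback (S : StateSpace m m n) (r : Fin m → ℕ) :
    (Fin n → ℝ) →ₗ[ℝ] (Fin m → ℝ) :=
  -((S.decouplingMatrix r)⁻¹ * S.delayedOutputMatrix r).mulVecLin

/-- The state update under the feedback that keeps the outputs at zero. -/
noncomputable def zeroingUpdate (S : StateSpace m m n) (r : Fin m → ℕ) :
    Module.End ℝ (Fin n → ℝ) :=
  S.A.mulVecLin + S.B.mulVecLin ∘ₗ S.zeroingFeedback r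

/-- The first `k` inputs under the feedback that keeps the outputs at zero. -/
noncomputable def zeroingInputs (S : StateSpace m m n) (r : Fin m → ℕ) (k : ℕ) :
    (Fin n → ℝ) →ₗ[ℝ] (Fin k → Fin m → ℝ) :=
  LinearMap.pi fun i => S.zeroingFeedback r ∘ₗ (S.zeroingUpdate r) ^ (i : ℕ)

theorem zeroingUpdate_apply (S : StateSpace m m n) (r : Fin m → ℕ) (x : Fin n → ℝ) :
    S.zeroingUpdate r x = S.A.mulVec x + S.B.mulVec (S.zeroingFeedback r x) :=
  rfl

section Output

variable {S : StateSpace m p n} {r : Fin p → ℕ}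

theorem HasVectorRelativeDegree.mulVec_apply (hr : S.HasVectorRelativeDegree r) {j : Fin p} {k : ℕ}
    (hk : k + 2 ≤ r j) (c : Fin m → ℝ) : (S.C * S.A ^ k * S.B).mulVec c j = 0 := by
  simp [Matrix.mulVec, (hr.1 j).1 k hk]

theorem HasVectorRelativeDegree.mulVec_D (hr : S.HasVectorRelativeDegree r) {j : Fin p}
    (hj : 0 < r j) (c : Fin m → ℝ) : S.D.mulVec c j = 0 := by
  simp [Matrix.mulVec, (hr.1 j).2 hj]

theorem decouplingMatrix_mulVec_of_eq_zero {j : Fin p} (hj : r j = 0) (c : Fin m → ℝ) :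
    (S.decouplingMatrix r).mulVec c j = S.D.mulVec c j := by
  simp [Matrix.mulVec, decouplingMatrix, hj]

theorem decouplingMatrix_mulVec_of_eq_succ {j : Fin p} {q : ℕ} (hj : r j = q + 1)
    (c : Fin m → ℝ) :
    (S.decouplingMatrix r).mulVec c j = (S.C * S.A ^ q * S.B).mulVec c j := by
  simp [Matrix.mulVec, decouplingMatrix, hj]

theorem delayedOutputMatrix_mulVec (x : Fin n → ℝ) (j : Fin p) :
    (S.delayedOutputMatrix r).mulVec x j = (S.C * S.A ^ r j).mulVec x j :=
  rfl

theorem mulVec_state_update (S : StateSpace m p n) (k : ℕ) (x : Fin n → ℝ) (c : Fin m → ℝ) :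
    (S.C * S.A ^ k).mulVec (S.A.mulVec x + S.B.mulVec c) =
      (S.C * S.A ^ (k + 1)).mulVec x + (S.C * S.A ^ k * S.B).mulVec c := by
  rw [Matrix.mulVec_add, Matrix.mulVec_mulVec, Matrix.mulVec_mulVec, Matrix.mul_assoc _ _ S.A,
    pow_succ]

variable {w : ℕ → Signal m p} {x : ℕ → Fin n → ℝ}

/-- Before the relative degree, the outputs depend on the state only. -/
theorem HasVectorRelativeDegree.output_eq (hr : S.HasVectorRelativeDegree r)
    (h : S.IsTrajectory w x) {j : Fin p} {i : ℕ} (hi : i < r j) (t : ℕ) :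
    (w (t + i)).2 j = (S.C * S.A ^ i).mulVec (x t) j := by
  induction i generalizing t with
  | zero => simp [(h t).2, hr.mulVec_D hi]
  | succ i ih =>
    rw [← add_assoc, add_right_comm, ih (by omega), (h t).1, mulVec_state_update, Pi.add_apply,
      hr.mulVec_apply (by omega), add_zero]

/-- Delay `r j` is the first at which the input reaches output j. Taken over all j, these equations
can be solved for the input in the square case. -/
theorem HasVectorRelativeDegree.output_eq' (hr : S.HasVectorRelativeDegree r)
    (h : S.IsTrajectory w x) (j : Fin p) (t : ℕ) :
    (w (t + r j)).2 j = (S.delayedOutputMatrix r).mulVec (x t) j +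
      (S.decouplingMatrix r).mulVec (w t).1 j := by
  rw [delayedOutputMatrix_mulVec]
  rcases hq : r j with _ | q
  · rw [decouplingMatrix_mulVec_of_eq_zero hq]
    simp [(h t).2]
  · rw [decouplingMatrix_mulVec_of_eq_succ hq, ← add_assoc, add_right_comm,
      hr.output_eq h (by omega), (h t).1, mulVec_state_update]
    rfl

end Output

section Square

variable {S : StateSpace m m n} {r : Fin m → ℕ}

theorem HasVectorRelativeDegree.mulVec_injective (hr : S.HasVectorRelativeDegree r) :
    Function.Injective (S.decouplingMatrix r).mulVec :=
  Matrix.mulVec_injective_of_rank_eq_card _ (by simpa using hr.2)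

theorem HasVectorRelativeDegree.isUnit_det (hr : S.HasVectorRelativeDegree r) :
    IsUnit (S.decouplingMatrix r).det :=
  (Matrix.isUnit_iff_isUnit_det _).1 (Matrix.mulVec_injective_iff_isUnit.1 hr.mulVec_injective)

theorem HasVectorRelativeDegree.add_eq_zero (hr : S.HasVectorRelativeDegree r) (x : Fin n → ℝ) :
    (S.delayedOutputMatrix r).mulVec x +
      (S.decouplingMatrix r).mulVec (S.zeroingFeedback r x) = 0 := by
  simp only [zeroingFeedback, LinearMap.neg_apply, Matrix.mulVecLin_apply, Matrix.mulVec_neg,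
    Matrix.mulVec_mulVec, ← Matrix.mul_assoc, Matrix.mul_nonsing_inv _ hr.isUnit_det,
    Matrix.one_mul, add_neg_cancel]

theorem HasVectorRelativeDegree.eq_zeroingFeedback (hr : S.HasVectorRelativeDegree r)
    {x : Fin n → ℝ} {c : Fin m → ℝ}
    (h : (S.delayedOutputMatrix r).mulVec x + (S.decouplingMatrix r).mulVec c = 0) :
    c = S.zeroingFeedback r x :=
  hr.mulVec_injective (add_left_cancel (h.trans (hr.add_eq_zero x).symm))

/-- For i + 1 < r_j the input does not enter C_j A^i; for i + 1 = r_j the feedback cancels C_j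
A^(r_j) x. -/
theorem HasVectorRelativeDegree.zeroingUpdate_mem (hr : S.HasVectorRelativeDegree r)
    {x : Fin n → ℝ} (hx : x ∈ S.zeroingSubspace r) :
    S.zeroingUpdate r x ∈ S.zeroingSubspace r := by
  intro j i hi
  rw [zeroingUpdate_apply, mulVec_state_update, Pi.add_apply]
  rcases (Nat.succ_le_of_lt hi).eq_or_lt with h | h
  · have := congrFun (hr.add_eq_zero x) j
    rwa [Pi.add_apply, delayedOutputMatrix_mulVec,
      decouplingMatrix_mulVec_of_eq_succ (q := i) h.symm, ← h] at this
  · rw [hx j (i + 1) h, hr.mulVec_apply h, add_zero]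

theorem HasVectorRelativeDegree.zeroingUpdate_pow_mem (hr : S.HasVectorRelativeDegree r)
    {x : Fin n → ℝ} (hx : x ∈ S.zeroingSubspace r) (t : ℕ) :
    (S.zeroingUpdate r ^ t) x ∈ S.zeroingSubspace r := by
  induction t with
  | zero => exact hx
  | succ t ih =>
    rw [pow_succ', Module.End.mul_apply]
    exact hr.zeroingUpdate_mem ih

theorem HasVectorRelativeDegree.output_eq_zero (hr : S.HasVectorRelativeDegree r)
    {x : Fin n → ℝ} (hx : x ∈ S.zeroingSubspace r) :
    S.C.mulVec x + S.D.mulVec (S.zeroingFeedback r x) = 0 := by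
  funext j
  rcases (r j).eq_zero_or_pos with h | h
  · have := congrFun (hr.add_eq_zero x) j
    rwa [Pi.add_apply, delayedOutputMatrix_mulVec, decouplingMatrix_mulVec_of_eq_zero h, h,
      pow_zero, Matrix.mul_one] at this
  · have := hx j 0 h
    rw [pow_zero, Matrix.mul_one] at this
    rw [Pi.add_apply, this, hr.mulVec_D h, add_zero]
    rfl

/-- The feedback generates trajectories with zero output from the zeroing subspace. -/
theorem HasVectorRelativeDegree.isTrajectory_zeroing (hr : S.HasVectorRelativeDegree r)
    {x : Fin n → ℝ} (hx : x ∈ S.zeroingSubspace r) :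
    S.IsTrajectory (fun t => (S.zeroingFeedback r ((S.zeroingUpdate r ^ t) x), 0))
      (fun t => (S.zeroingUpdate r ^ t) x) := fun t => by
  refine ⟨?_, (hr.output_eq_zero (hr.zeroingUpdate_pow_mem hx t)).symm⟩
  change (S.zeroingUpdate r ^ (t + 1)) x = _
  rw [pow_succ', Module.End.mul_apply, zeroingUpdate_apply]

variable {w : ℕ → Signal m m} {x : ℕ → Fin n → ℝ}

/-- While the outputs are zero, the state stays in the zeroing subspace and the input is
generated by the feedback. -/
theorem HasVectorRelativeDegree.zero_output (hr : S.HasVectorRelativeDegree r)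
    (h : S.IsTrajectory w x) {L : ℕ} (hw : ∀ t < L, (w t).2 = 0) {t : ℕ}
    (ht : t + Finset.univ.sup r < L) :
    x t ∈ S.zeroingSubspace r ∧ (w t).1 = S.zeroingFeedback r (x t) ∧
      x t = (S.zeroingUpdate r ^ t) (x 0) := by
  have hle : ∀ j, r j ≤ Finset.univ.sup r := fun j => Finset.le_sup (Finset.mem_univ j)
  -- The input at time s is read off from the outputs at the times s + r_j, hence the margin max r_j
  -- before L.
  have hu : ∀ s ≤ t, (w s).1 = S.zeroingFeedback r (x s) := by
    intro s hs
    refine hr.eq_zeroingFeedback (funext fun j => ?_)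
    have := hle j
    rw [Pi.add_apply, ← hr.output_eq' h, hw _ (by omega)]
  refine ⟨fun j i hi => ?_, hu t le_rfl, ?_⟩
  · have := hle j
    rw [← hr.output_eq h hi, hw _ (by omega)]
    rfl
  · have : ∀ s ≤ t, x s = (S.zeroingUpdate r ^ s) (x 0) := by
      intro s
      induction s with
      | zero => exact fun _ => rfl
      | succ s ih =>
        intro hs
        rw [pow_succ', Module.End.mul_apply, ← ih (by omega), zeroingUpdate_apply, (h s).1,
          hu s (by omega)]
    exact this t le_rfl

theorem HasVectorRelativeDegree.zeroingInputs_injOn (hr : S.HasVectorRelativeDegree r) {ℓ : ℕ}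
    (hobs : S.IsObservableIn ℓ) {y : Fin n → ℝ} (hy : y ∈ S.zeroingSubspace r)
    (h : S.zeroingInputs r ℓ y = 0) : y = 0 := by
  refine hobs.state_eq (hr.isTrajectory_zeroing hy) S.trajectories.zero_mem (t := 0) (t' := 0)
    fun i hi => ?_
  rw [zero_add]
  exact Prod.ext (congrFun h ⟨i, hi⟩) rfl

/-- Multiply a vanishing combination by A^k B, by strong induction on k = r_j - 1 - i. Terms with
smaller i vanish by the relative degree, those with larger i by induction, and the rest combine rows
of the invertible decoupling matrix. -/
theorem HasVectorRelativeDegree.linearIndependent (hr : S.HasVectorRelativeDegree r) :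
    LinearIndependent ℝ fun q : Σ j : Fin m, Fin (r j) => (S.C * S.A ^ (q.2 : ℕ)) q.1 := by
  rw [Fintype.linearIndependent_iff]
  intro g hg
  have key : ∀ k, ∀ q : Σ j : Fin m, Fin (r j), (q.2 : ℕ) + 1 + k = r q.1 → g q = 0 := by
    intro k
    induction k using Nat.strong_induction_on with
    | _ k ih =>
      let e : Fin m → ℝ := fun j => if h : k + 1 ≤ r j then g ⟨j, ⟨r j - (k + 1), by omega⟩⟩ else 0
      have h1 : (S.decouplingMatrix r).transpose.mulVec e = 0 := by
        have h2 := congrArg (fun z => Matrix.vecMul z (S.A ^ k * S.B)) hg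
        simp only [Matrix.zero_vecMul] at h2
        rw [Matrix.mulVec_transpose, ← h2]
        funext c
        have h3 : ∀ (j : Fin m) (i : ℕ), Matrix.vecMul ((S.C * S.A ^ i) j)
            (S.A ^ k * S.B) = (S.C * S.A ^ (i + k) * S.B) j := by
          intro j i
          rw [pow_add, ← Matrix.mul_assoc S.C, Matrix.mul_assoc _ _ S.B]
          rfl
        simp only [Matrix.sum_vecMul, Matrix.smul_vecMul, h3, Finset.sum_apply, Pi.smul_apply,
          smul_eq_mul, Fintype.sum_sigma]
        rw [Matrix.vecMul, dotProduct]
        refine Finset.sum_congr rfl fun j _ => ?_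
        by_cases hk : k + 1 ≤ r j
        · rw [Finset.sum_eq_single ⟨r j - (k + 1), by omega⟩]
          · simp only [e, dif_pos hk, decouplingMatrix, Matrix.of_apply]
            rw [if_neg (by omega), show r j - (k + 1) + k = r j - 1 by omega]
          · intro i _ hi
            have hi' : (i : ℕ) ≠ r j - (k + 1) := fun h => hi (Fin.ext h)
            have := i.2
            rcases lt_or_gt_of_ne hi' with h | h
            · rw [(hr.1 j).1 _ (by omega), Pi.zero_apply, mul_zero]
            · rw [ih (r j - 1 - i) (by omega) ⟨j, i⟩ (by simp only; omega), zero_mul]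
          · simp
        · rw [Finset.sum_eq_zero]
          · simp only [e, dif_neg hk, zero_mul]
          · intro i _
            have := i.2
            rw [ih (r j - 1 - i) (by omega) ⟨j, i⟩ (by simp only; omega), zero_mul]
      have h4 : e = 0 := by
        refine Matrix.mulVec_injective_of_rank_eq_card (S.decouplingMatrix r).transpose ?_ ?_
        · rw [Matrix.rank_transpose]
          simpa using hr.2
        · rw [h1, Matrix.mulVec_zero]
      rintro ⟨j, i⟩ hq
      simp only at hq
      have h5 := congrFun h4 j
      have hi : i = ⟨r j - (k + 1), by omega⟩ := Fin.ext (by simp only; omega)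
      simp only [e, dif_pos (show k + 1 ≤ r j by omega), Pi.zero_apply] at h5
      rw [hi]
      exact h5
  intro q
  have := q.2.2
  exact key (r q.1 - 1 - q.2) q (by omega)

theorem HasVectorRelativeDegree.finrank_zeroingSubspace (hr : S.HasVectorRelativeDegree r) :
    Module.finrank ℝ (S.zeroingSubspace r) + ∑ j, r j = n := by
  let P : Matrix (Σ j : Fin m, Fin (r j)) (Fin n) ℝ :=
    Matrix.of fun q => (S.C * S.A ^ (q.2 : ℕ)) q.1
  have hker : S.zeroingSubspace r = LinearMap.ker P.mulVecLin := by
    ext y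
    rw [LinearMap.mem_ker, Matrix.mulVecLin_apply]
    exact ⟨fun h => funext fun q => h q.1 q.2 q.2.2,
      fun h j i hi => congrFun h ⟨j, ⟨i, hi⟩⟩⟩
  have hrank : P.rank = ∑ j, r j := by
    rw [hr.linearIndependent.rank_matrix (M := P)]
    simp
  have := P.mulVecLin.finrank_range_add_finrank_ker
  rw [Module.finrank_fin_fun, ← hker] at this
  rw [← hrank, add_comm]
  exact this

end Square

end StateSpace

/-! ### Input windows of the zero dynamics and the main theorem -/

/-- The margin max r_j beyond k makes zero output force the feedback law at all times below k.
`hpos` is needed for k = 0, to place the initial state in the zeroing subspace. -/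
theorem firstEntries_zeroOutputInputs {m n k L : ℕ} (hk : k ≤ L) {𝓑 : Behavior m m}
    {S : StateSpace m m n} (hS : S.Represents 𝓑) {r : Fin m → ℕ}
    (hr : S.HasVectorRelativeDegree r) (hL : k + Finset.univ.sup r ≤ L)
    (hpos : Finset.univ.sup r < L) :
    firstEntries hk (zeroOutputInputs 𝓑 L) = (S.zeroingSubspace r).map (S.zeroingInputs r k) := by
  ext q
  constructor
  · rintro ⟨u, ⟨w, hw, hwu⟩, rfl⟩
    obtain ⟨x, hx⟩ := (hS w).1 hw
    have hw2 : ∀ t < L, (w t).2 = 0 := fun t ht => congrArg Prod.snd (congrFun hwu ⟨t, ht⟩)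
    refine ⟨x 0, (hr.zero_output hx hw2 (t := 0) (by omega)).1, funext fun i => ?_⟩
    obtain ⟨-, h2, h3⟩ := hr.zero_output hx hw2 (t := i) (by omega)
    have h1 : (w i).1 = u (Fin.castLE hk i) := congrArg Prod.fst (congrFun hwu (Fin.castLE hk i))
    rw [h3] at h2
    exact h2.symm.trans h1
  · rintro ⟨y, hy, rfl⟩
    exact ⟨S.zeroingInputs r L y,
      ⟨_, hS.mem_of_isTrajectory (hr.isTrajectory_zeroing hy), rfl⟩, rfl⟩

theorem extend_zeroingInputs {m n : ℕ} (S : StateSpace m m n) (r : Fin m → ℕ) (ℓ : ℕ)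
    (y : Fin n → ℝ) : extend (S.zeroingInputs r ℓ y)
      (S.zeroingFeedback r ((S.zeroingUpdate r ^ ℓ) y)) = S.zeroingInputs r (ℓ + 1) y := by
  funext i
  refine Fin.lastCases ?_ (fun i => ?_) i
  · exact Fin.snoc_last (α := fun _ => Fin m → ℝ) _ _
  · exact Fin.snoc_castSucc (α := fun _ => Fin m → ℝ) _ _ _

theorem tail_zeroingInputs {m n : ℕ} (S : StateSpace m m n) (r : Fin m → ℕ) (ℓ : ℕ)
    (y : Fin n → ℝ) : Fin.tail (S.zeroingInputs r (ℓ + 1) y) =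
      S.zeroingInputs r ℓ (S.zeroingUpdate r y) := by
  funext i
  change S.zeroingFeedback r ((S.zeroingUpdate r ^ ((i : ℕ) + 1)) y) = _
  rw [pow_succ]
  rfl

theorem extend_injective {m ℓ : ℕ} {v v' : Fin ℓ → Fin m → ℝ} {c c' : Fin m → ℝ}
    (h : extend v c = extend v' c') : v = v' ∧ c = c' := by
  refine ⟨funext fun i => ?_, ?_⟩
  · have := congrFun h i.castSucc
    rwa [extend, extend, Fin.snoc_castSucc, Fin.snoc_castSucc] at this
  · have := congrFun h (Fin.last ℓ)
    rwa [extend, extend, Fin.snoc_last, Fin.snoc_last] at this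

/-- The powers of the transposed matrix of an endomorphism tend to zero if and only if all its
orbits do. -/
theorem isSchurStable_transpose_toMatrix_iff {W : Type*} [AddCommGroup W] [Module ℝ W]
    {d : ℕ} (b : Module.Basis (Fin d) ℝ W) (G : Module.End ℝ W) :
    IsSchurStable (LinearMap.toMatrix b b G).transpose ↔
      ∀ y i, Tendsto (fun t : ℕ => b.repr ((G ^ t) y) i) atTop (𝓝 0) := by
  rw [isSchurStable_iff_tendsto_pow]
  have hpow : ∀ t i j, ((LinearMap.toMatrix b b G).transpose ^ t) i j =
      b.repr ((G ^ t) (b i)) j := by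
    intro t i j
    have h1 : LinearMap.toMatrix b b G ^ t = LinearMap.toMatrix b b (G ^ t) :=
      (map_pow (LinearMap.toMatrixAlgEquiv b) G t).symm
    rw [← Matrix.transpose_pow, h1, Matrix.transpose_apply, LinearMap.toMatrix_apply]
  simp only [hpow]
  refine ⟨fun h y i => ?_, fun h i j => h (b i) j⟩
  have := tendsto_finsetSum Finset.univ fun k _ => (h k i).const_mul (b.repr y k)
  simp only [mul_zero, Finset.sum_const_zero] at this
  refine this.congr fun t => ?_
  conv_rhs => rw [← b.sum_repr y, map_sum, map_sum, Finsupp.finsetSum_apply]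
  simp only [map_smul, Finsupp.smul_apply, smul_eq_mul]

theorem mainTheorem6 {m : ℕ} (𝓑 : Behavior m m) (h𝓑 : 𝓑.IsLTIComplete)
    (hctrl : 𝓑.IsControllable) (hn : 0 < 𝓑.mcMillanDegree)
    (r : Fin m → ℕ) (hr : 𝓑.HasVectorRelativeDegree r)
    (T L : ℕ) (hL : 𝓑.lag + Finset.univ.sup r + 1 ≤ L)
    (ud yd : Fin (T + 1) → Fin m → ℝ)
    (hdata : (fun i => (ud i, yd i)) ∈ 𝓑.restrict (T + 1))
    (hpe : IsPersistentlyExciting ud (L + 𝓑.mcMillanDegree))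
    (M : Submodule ℝ (Fin L → Fin m → ℝ))
    (hM : M = zeroOutputInputs (mostPowerfulUnfalsifiedModel 𝓑.lag ud yd) L)
    (V : Submodule ℝ (Fin 𝓑.lag → Fin m → ℝ))
    (hV : V = firstEntries (by omega) M)
    (V' : Submodule ℝ (Fin (𝓑.lag + 1) → Fin m → ℝ))
    (hV' : V' = firstEntries (by omega) M)
    (d : ℕ) (v : Module.Basis (Fin d) ℝ V) :
    d + ∑ j, r j = 𝓑.mcMillanDegree ∧
    (∀ k, ∃! c : Fin m → ℝ, extend (v k : Fin 𝓑.lag → Fin m → ℝ) c ∈ V') ∧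
    (∃! Q : Matrix (Fin d) (Fin d) ℝ, IsContinuationMatrix V' v Q) ∧
    ∀ Q : Matrix (Fin d) (Fin d) ℝ, IsContinuationMatrix V' v Q →
      (𝓑.HasStableZeroDynamics ↔ IsSchurStable Q) := by
  obtain ⟨n₀, S₀, hS₀, hrS₀⟩ := id hr
  obtain ⟨S, hmin, hobs⟩ := Behavior.exists_isMinimalRepresentation hS₀
  have hS : S.Represents 𝓑 := hmin
  have hrS := hS.hasVectorRelativeDegree hobs hr
  rw [Behavior.mostPowerfulUnfalsifiedModel_eq h𝓑 hctrl hS hobs hn (L := L) (by omega) hdata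
    hpe] at hM
  have hVW : V = (S.zeroingSubspace r).map (S.zeroingInputs r 𝓑.lag) := by
    rw [hV, hM]
    exact firstEntries_zeroOutputInputs _ hS hrS (by omega) (by omega)
  have hVW' : V' = (S.zeroingSubspace r).map (S.zeroingInputs r (𝓑.lag + 1)) := by
    rw [hV', hM]
    exact firstEntries_zeroOutputInputs _ hS hrS (by omega) (by omega)
  have hlag : 0 < 𝓑.lag := by
    rcases Nat.eq_zero_or_pos 𝓑.lag with h0 | h0
    · have h1 := hobs (Pi.single ⟨0, hn⟩ 1) (fun i hi => by omega)
      have h2 := congrFun h1 ⟨0, hn⟩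
      simp at h2
    · exact h0
  set ψ := S.zeroingInputs r 𝓑.lag with hψ
  set Z := S.zeroingUpdate r with hZ
  set K := S.zeroingFeedback r with hK
  have hinj : ∀ y ∈ S.zeroingSubspace r, ∀ z ∈ S.zeroingSubspace r, ψ y = ψ z → y = z := by
    intro y hy z hz h
    rw [← sub_eq_zero]
    exact hrS.zeroingInputs_injOn hobs (Submodule.sub_mem _ hy hz)
      (by rw [map_sub, ← hψ, h, sub_self])
  let φ₀ : S.zeroingSubspace r →ₗ[ℝ] V :=
    (ψ.domRestrict (S.zeroingSubspace r)).codRestrict V fun y => by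
      rw [hVW]
      exact ⟨y, y.2, rfl⟩
  have hφ₀ : Function.Bijective φ₀ := by
    constructor
    · intro y z h
      exact Subtype.ext (hinj y y.2 z z.2 (congrArg Subtype.val h))
    · rintro ⟨q, hq⟩
      obtain ⟨y, hy, hyq⟩ := hVW ▸ hq
      exact ⟨⟨y, hy⟩, Subtype.ext hyq⟩
  let φ := LinearEquiv.ofBijective φ₀ hφ₀
  -- The given basis transported to the zeroing subspace, where shift and continuation become the
  -- update `G`.
  let b := v.map φ.symm
  have hvb : ∀ k, (v k : Fin 𝓑.lag → Fin m → ℝ) = ψ (b k) := by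
    intro k
    have : φ (b k) = v k := by simp [b]
    rw [← this]
    rfl
  let G : Module.End ℝ (S.zeroingSubspace r) := Z.restrict fun y hy => hrS.zeroingUpdate_mem hy
  have hGpow : ∀ t y, ((G ^ t) y : Fin 𝓑.mcMillanDegree → ℝ) = (Z ^ t) y := by
    intro t y
    rw [Module.End.pow_restrict]
    rfl
  -- The first `lag` inputs determine the initial state, hence the next input.
  have hext : ∀ k c, extend (v k : Fin 𝓑.lag → Fin m → ℝ) c ∈ V' ↔ c = K ((Z ^ 𝓑.lag) (b k)) := by
    intro k c
    rw [hVW', hvb]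
    constructor
    · rintro ⟨y, hy, hyc⟩
      rw [← extend_zeroingInputs] at hyc
      obtain ⟨h1, h2⟩ := extend_injective hyc
      rw [← hinj y hy _ (b k).2 h1]
      exact h2.symm
    · rintro rfl
      exact ⟨b k, (b k).2, (extend_zeroingInputs S r 𝓑.lag _).symm⟩
  -- Row k of `Q` holds the coordinates of `G (b k)`, which form column k of the matrix of `G`;
  -- hence the transpose.
  have hQ : ∀ Q, IsContinuationMatrix V' v Q ↔ Q = (LinearMap.toMatrix b b G).transpose := by
    intro Q
    have h1 : IsContinuationMatrix V' v Q ↔ ∀ k, G (b k) = ∑ i, Q k i • b i := by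
      have h2 : ∀ k, Fin.tail (extend (v k : Fin 𝓑.lag → Fin m → ℝ) (K ((Z ^ 𝓑.lag) (b k)))) =
          ∑ i, Q k i • (v i : Fin 𝓑.lag → Fin m → ℝ) ↔ G (b k) = ∑ i, Q k i • b i := by
        intro k
        simp only [hvb]
        rw [extend_zeroingInputs, tail_zeroingInputs, ← φ.injective.eq_iff, Subtype.ext_iff,
          map_sum]
        simp only [map_smul, Submodule.coe_sum, Submodule.coe_smul]
        exact Iff.rfl
      constructor
      · rintro ⟨c, hc⟩ k
        rw [← h2, ← (hext k (c k)).1 (hc k).1]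
        exact (hc k).2
      · intro h
        exact ⟨fun k => K ((Z ^ 𝓑.lag) (b k)), fun k => ⟨(hext k _).2 rfl, (h2 k).2 (h k)⟩⟩
    rw [h1]
    constructor
    · intro h
      ext k i
      rw [Matrix.transpose_apply, LinearMap.toMatrix_apply, h k]
      simp [Finsupp.finsetSum_apply, Finsupp.single_apply]
    · rintro rfl k
      simp only [Matrix.transpose_apply, LinearMap.toMatrix_apply]
      exact (b.sum_repr _).symm
  refine ⟨?_, fun k => ⟨_, (hext k _).2 rfl, fun c hc => (hext k c).1 hc⟩,
    ⟨_, (hQ _).2 rfl, fun Q h => (hQ Q).1 h⟩, fun Q h => ?_⟩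
  · have h1 := hrS.finrank_zeroingSubspace
    rwa [Module.finrank_eq_card_basis b, Fintype.card_fin] at h1
  rw [(hQ Q).1 h, isSchurStable_transpose_toMatrix_iff]
  constructor
  · intro hst y i
    have htraj := hrS.isTrajectory_zeroing y.2
    have h1 := (hst _ (hS.mem_of_isTrajectory htraj) S hmin _ htraj).1
    have h2 : Tendsto (fun t => (G ^ t) y) atTop (𝓝 0) := by
      rw [tendsto_subtype_rng]
      exact h1.congr fun t => (hGpow t y).symm
    have h3 := ((LinearMap.continuous_of_finiteDimensional (b.coord i)).tendsto 0).comp h2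
    rw [map_zero] at h3
    exact h3
  · intro hst u hu S' hS' x' hx'
    obtain ⟨x, hx⟩ := (hS _).1 hu
    -- The output vanishes at all times, so the horizon may grow with t.
    have hz := fun t => hrS.zero_output hx (L := t + Finset.univ.sup r + 1) (t := t)
      (fun _ _ => rfl) (by omega)
    have h1 : Tendsto (fun t => (G ^ t) ⟨x 0, (hz 0).1⟩) atTop (𝓝 0) := by
      have h2 := tendsto_finsetSum Finset.univ fun i _ =>
        (hst ⟨x 0, (hz 0).1⟩ i).smul_const (b i)
      simp only [zero_smul, Finset.sum_const_zero, b.sum_repr] at h2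
      exact h2
    have h2 : Tendsto x atTop (𝓝 0) := by
      rw [tendsto_subtype_rng] at h1
      refine h1.congr fun t => ?_
      rw [hGpow]
      exact (hz t).2.2.symm
    have h3 : Tendsto u atTop (𝓝 0) := by
      have h4 := ((LinearMap.continuous_of_finiteDimensional K).tendsto 0).comp h2
      rw [map_zero] at h4
      exact h4.congr fun t => (hz t).2.1.symm
    -- `S'` may differ from `S`, so convergence of its state comes from that of (u, 0) by
    -- observability.
    refine ⟨hS'.isObservableIn.tendsto_state hx' ?_, h3⟩
    exact h3.prodMk_nhds tendsto_const_nhds
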